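/- Let $N\ge 2$, $m\ge 0$ and $0\le k\le N-2$ be integers, and let $\Omega\subset\mathbf R^N$ be open and invariant under rotations about the origin. Let $\mathcal X$ be a class of functions $v:\Omega\to\mathbf R^m$ that are locally integrable and have a locally integrable weak gradient $\nabla v$ on $\Omega$. Let $F,G_1,\dots,G_k$ be real-valued functions on $A_\Omega\times\mathbf R^m\times[0,\infty)$, where $A_\Omega=\{|x| : x\in\Omega\}$, such that for every $v\in\mathcal X$ the functions $x\mapsto F(|x|,v(x),|\nabla v(x)|)$ and $x\mapsto G_j(|x|,v(x),|\nabla v(x)|)$, $1\le j\le k$, belong to $L^1(\Omega)$; here $|\nabla v|=\big(\sum_{i,j}|\partial_i v_j|^2\big)^{1/2}$. For given $\lambda_1,\dots,\lambda_k\in\mathbf R$, consider the problem $$(\mathcal P)\qquad \text{minimize } E(v)=\int_\Omega F(|x|,v(x),|\nabla v(x)|)\,dx \text{ over all } v\in\mathcal X \text{ with } \int_\Omega G_j(|x|,v(x),|\nabla v(x)|)\,dx=\lambda_j,\ \ j=1,\dots,k.$$ For a hyperplane $\Pi$ containing the origin, let $\Pi^+$ and $\Pi^-$ be the two open half-spaces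 that it bounds and $s_\Pi$ the orthogonal reflection across $\Pi$; let $v_{\Pi^+}$ be equal to $v$ on $\Omega\cap(\Pi^+\cup\Pi)$ and to $v\circ s_\Pi$ on $\Omega\cap\Pi^-$, and let $v_{\Pi^-}$ be equal to $v$ on $\Omega\cap(\Pi^-\cup\Pi)$ and to $v\circ s_\Pi$ on $\Omega\cap\Pi^+$. Assume: (A1) for every $v\in\mathcal X$ and every hyperplane $\Pi$ containing the origin, $v_{\Pi^+},v_{\Pi^-}\in\mathcal X$; (A2) every minimizer of $(\mathcal P)$ in $\mathcal X$ is a $C^1$ function on $\Omega$ (that is, it coincides almost everywhere on $\Omega$ with a $C^1$ function, with which it is identified). Then for every minimizer $u\in\mathcal X$ of $(\mathcal P)$ there exists a $k$-dimensional vector subspace $V$ of $\mathbf R^N$ such that $u$ is radially symmetric with respect to $V$: there is a function $\tilde u$ on $V\times[0,\infty)$ such that $u(x)=\tilde u\big(p_V(x),|x-p_V(x)|\big)$ for all $x\in\Omega$, where $p_V$ is the orthogonal projection onto $V$. -/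

import Mathlib

open MeasureTheory Set
open scoped ContDiff

noncomputable section

namespace MinSym

/-- `ℝⁿ` with the Euclidean norm and inner product. -/
abbrev Euc (n : ℕ) : Type := EuclideanSpace ℝ (Fin n)

/-- `Ω` is invariant under all rotations of `ℝᴺ` about the origin. -/
def RotationInvariant {N : ℕ} (Ω : Set (Euc N)) : Prop :=
  ∀ R : Euc N ≃ₗᵢ[ℝ] Euc N,
    LinearMap.det (R.toLinearEquiv : Euc N →ₗ[ℝ] Euc N) = 1 → R '' Ω = Ω

/-- `v` and `D` are locally integrable on `Ω`, and `D` is the weak (distributional) derivative of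
`v : Ω → ℝᵐ`; `D x` is the differential at `x`, whose matrix is the Jacobian matrix `∇v(x)`. -/
def IsWeakGradient {N m : ℕ} (Ω : Set (Euc N)) (v : Euc N → Euc m)
    (D : Euc N → (Euc N →L[ℝ] Euc m)) : Prop :=
  LocallyIntegrableOn v Ω volume ∧ LocallyIntegrableOn D Ω volume ∧
    ∀ φ : Euc N → ℝ, ContDiff ℝ ∞ φ → HasCompactSupport φ → tsupport φ ⊆ Ω →
      ∀ e : Euc N, ∫ x in Ω, (fderiv ℝ φ x e) • v x = -∫ x in Ω, φ x • D x e

/-- `v` belongs to `W^{1,1}_loc(Ω; ℝᵐ)`. -/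
def WeaklyDifferentiable {N m : ℕ} (Ω : Set (Euc N)) (v : Euc N → Euc m) : Prop :=
  ∃ D : Euc N → (Euc N →L[ℝ] Euc m), IsWeakGradient Ω v D

open Classical in
/-- A representative of the weak gradient of `v` on `Ω` (it is unique up to null sets when `Ω` is
open; the value is irrelevant if `v` is not weakly differentiable). -/
def weakGrad {N m : ℕ} (Ω : Set (Euc N)) (v : Euc N → Euc m) :
    Euc N → (Euc N →L[ℝ] Euc m) :=
  if h : WeaklyDifferentiable Ω v then h.choose else 0

/-- The Euclidean norm `(∑ᵢⱼ |∂ᵢvⱼ|²)^{1/2}` of a gradient. -/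
def gradNorm {N m : ℕ} (D : Euc N →L[ℝ] Euc m) : ℝ :=
  Real.sqrt (∑ i : Fin N, ‖D (EuclideanSpace.single i 1)‖ ^ 2)

/-- The integrand `x ↦ H(|x|, v(x), |∇v(x)|)`. -/
def density {N m : ℕ} (Ω : Set (Euc N)) (H : ℝ → Euc m → ℝ → ℝ) (v : Euc N → Euc m) :
    Euc N → ℝ :=
  fun x => H ‖x‖ (v x) (gradNorm (weakGrad Ω v x))

/-- The functional `∫_Ω H(|x|, v(x), |∇v(x)|) dx`. -/
def functional {N m : ℕ} (Ω : Set (Euc N)) (H : ℝ → Euc m → ℝ → ℝ) (v : Euc N → Euc m) : ℝ :=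
  ∫ x in Ω, density Ω H v x

/-- `u` minimizes `∫_Ω F(|x|, u, |∇u|) dx` among all members of the class `X` that satisfy
`∫_Ω G_j(|x|, u, |∇u|) dx = c_j` for all `j`. -/
def IsMinimizer {N m k : ℕ} (Ω : Set (Euc N)) (X : Set (Euc N → Euc m))
    (F : ℝ → Euc m → ℝ → ℝ) (G : Fin k → ℝ → Euc m → ℝ → ℝ) (c : Fin k → ℝ)
    (u : Euc N → Euc m) : Prop :=
  (u ∈ X ∧ ∀ j, functional Ω (G j) u = c j) ∧
    ∀ v ∈ X, (∀ j, functional Ω (G j) v = c j) → functional Ω F u ≤ functional Ω F v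

/-- The orthogonal reflection `s_Π` across the hyperplane `Π = e^⊥`. -/
def hyperplaneRefl {N : ℕ} (e : Euc N) : Euc N ≃ₗᵢ[ℝ] Euc N :=
  (Submodule.span ℝ {e})ᗮ.reflection

/-- `f_{Π⁺}` for `Π = e^⊥`, `Π⁺ = {x | ⟨e, x⟩ > 0}`: equal to `f` on `Π⁺ ∪ Π` and to `f ∘ s_Π` on
`Π⁻`. -/
def reflectPos {N m : ℕ} (e : Euc N) (f : Euc N → Euc m) : Euc N → Euc m :=
  fun x => if 0 ≤ inner ℝ e x then f x else f (hyperplaneRefl e x)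

/-- `f_{Π⁻}` for `Π = e^⊥`, `Π⁻ = {x | ⟨e, x⟩ < 0}`: equal to `f` on `Π⁻ ∪ Π` and to `f ∘ s_Π` on
`Π⁺`. -/
def reflectNeg {N m : ℕ} (e : Euc N) (f : Euc N → Euc m) : Euc N → Euc m :=
  fun x => if inner ℝ e x ≤ 0 then f x else f (hyperplaneRefl e x)

/-- The class `X` is closed under reflection across every hyperplane through the origin. -/
def ReflectionClosed {N m : ℕ} (X : Set (Euc N → Euc m)) : Prop :=
  ∀ v ∈ X, ∀ e : Euc N, e ≠ 0 → reflectPos e v ∈ X ∧ reflectNeg e v ∈ X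

/-- `w` is a `C¹` representative of `u` on `Ω`. -/
def IsC1Rep {N m : ℕ} (Ω : Set (Euc N)) (u w : Euc N → Euc m) : Prop :=
  ContDiffOn ℝ 1 w Ω ∧ u =ᵐ[volume.restrict Ω] w

/-- `f : Ω → ℝᵐ` is radially symmetric with respect to `V`: on `Ω`, `f(x)` is a function of
`p_V(x)` and `|x - p_V(x)|`. -/
def RadiallySymmetric {N m : ℕ} (Ω : Set (Euc N)) (V : Submodule ℝ (Euc N))
    (f : Euc N → Euc m) : Prop :=
  ∃ g : V → ℝ → Euc m, ∀ x ∈ Ω,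
    f x = g (V.orthogonalProjectionOnto x) ‖x - (V.orthogonalProjectionOnto x : Euc N)‖

end MinSym

end

open MinSym

/-!
Reflection across a hyperplane `Π` that bisects all the constraint integrals turns a minimizer `u`
into the minimizers `u_{Π⁺}` and `u_{Π⁻}`, because the energies of the two add up to twice the
minimum. As both are `C¹`, the normal derivative of `u` vanishes on `Π` (`fderiv_normal_eq_zero`).
The proof collects enough such hyperplanes to show that the derivative of `u` vanishes along all
infinitesimal rotations `f ∧ g : x ↦ ⟨f, x⟩ g - ⟨g, x⟩ f` of a subspace `W` of dimension `N - k ≥ 2`.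
Then `u` is constant along circles in the translates of `W`, that is, radially symmetric with respect
to `V = W^⊥`.

Existence of bisecting hyperplanes is the Borsuk–Ulam theorem (`borsuk_ulam`), which is proved
algebraically. By the Stone–Weierstrass theorem it suffices to find approximate common zeros, on the
unit sphere, of `n` forms of odd degree `d` in `n + 1` variables. On an affine chart and after a
perturbation these become a system `Xᵢᵈ + s gᵢ = 0` with `deg gᵢ ≤ d`. For all but countably many
real `s` the quotient of the polynomial ring by this system has dimension `dⁿ`
(`countable_not_bijective_powSubst`), an odd number, so the multiplications by the variables have a
common real eigenvector (`exists_common_eigenvector`), and its eigenvalues solve the system.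

Let `Z` be the set of normals `f` of bisecting hyperplanes of `u`. For `f ∈ Z`, reflect `u` across
`f^⊥`, and then across a hyperplane `f'^⊥` with `f' ⊥ f` that bisects the constraints of the result.
The function obtained is symmetric in both hyperplanes, so all hyperplanes with normal in the plane
of `f` and `f'` bisect its constraints, and it is invariant under `f ∧ f'`. Hence `u` is invariant
under `f ∧ f'` on the side `⟨f, x⟩ > 0`, and likewise on the other side for another `f'`
(`IsReflectiveProblem.exists_infInvariantOn_halfPart`). If `f, g ∈ Z` are not orthogonal, then in each
quadrant the invariances under `f ∧ f'`, `g ∧ g'` and their commutator give the one under `f ∧ g`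
(`InfInvariantOn.rotGen_of_inner_ne_zero`), so that `u` is invariant under `f ∧ g` on all of `Ω`.

Invariance under `f ∧ g` is an equivalence relation between nonzero vectors `f` and `g`. Therefore `Z`
is contained in a union of pairwise orthogonal subspaces `W`, on each of which `u` is invariant under
all rotations. If all of them had dimension less than `N - k`, they would embed by one linear map
`T : ℝᴺ → ℝ^(N-k-1)`, and Borsuk–Ulam applied to the `k` imbalances together with `T` would give a
member of `Z` in the kernel of `T`, a contradiction (`exists_submodule_infInvariantOn`).
-/

/-! ### Common eigenvectors in odd dimension -/

theorem Polynomial.exists_isRoot_of_monic_of_odd_natDegree {p : Polynomial ℝ} (hm : p.Monic)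
    (hodd : Odd p.natDegree) : ∃ x, p.IsRoot x := by
  have hdeg : 0 < p.degree := Polynomial.natDegree_pos_iff_degree_pos.mp hodd.pos
  have h1 : Filter.Tendsto (fun x => p.eval x) Filter.atTop Filter.atTop :=
    p.tendsto_atTop_of_leadingCoeff_nonneg hdeg (by simp [hm.leadingCoeff])
  have hnat : (p.comp (-Polynomial.X)).natDegree = p.natDegree := by
    simp [Polynomial.natDegree_comp]
  have h2 : Filter.Tendsto (fun x => (p.comp (-Polynomial.X)).eval x) Filter.atTop Filter.atBot := by
    refine Polynomial.tendsto_atBot_of_leadingCoeff_nonpos _ ?_ ?_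
    · rw [← Polynomial.natDegree_pos_iff_degree_pos, hnat]; exact hodd.pos
    · rw [Polynomial.leadingCoeff_comp (by simp)]
      simp [hm.leadingCoeff, hodd.neg_one_pow]
  have h3 : Filter.Tendsto (fun x => p.eval x) Filter.atBot Filter.atBot := by
    have := h2.comp Filter.tendsto_neg_atBot_atTop
    simpa [Function.comp_def] using this
  exact p.continuous.surjective h1 h3 0

/-- On a real vector space of odd dimension, all elements of a commutative algebra acting on it have
a common eigenvector: if `a` does not act by a scalar and `r` is a real eigenvalue of `a`, the
kernel and the range of `a - r` are proper submodules, and one of them has odd dimension. -/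
theorem exists_common_eigenvector {A : Type*} [CommRing A] [Algebra ℝ A] {M : Type*}
    [AddCommGroup M] [Module ℝ M] [Module A M] [IsScalarTower ℝ A M] [Module.Finite ℝ M]
    (hodd : Odd (Module.finrank ℝ M)) : ∃ v : M, v ≠ 0 ∧ ∀ a : A, ∃ r : ℝ, a • v = r • v := by
  obtain ⟨n, hn⟩ : ∃ n, Module.finrank ℝ M = n := ⟨_, rfl⟩
  induction n using Nat.strong_induction_on generalizing M with
  | _ n ih =>
    by_cases hscal : ∀ a : A, ∃ r : ℝ, ∀ v : M, a • v = r • v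
    · have : Nontrivial M := Module.nontrivial_of_finrank_pos (R := ℝ) hodd.pos
      obtain ⟨v, hv⟩ := exists_ne (0 : M)
      refine ⟨v, hv, fun a => ?_⟩
      obtain ⟨r, hr⟩ := hscal a
      exact ⟨r, hr v⟩
    push Not at hscal
    obtain ⟨a, ha⟩ := hscal
    let T : M →ₗ[ℝ] M := (LinearMap.lsmul A M a).restrictScalars ℝ
    obtain ⟨r, hr⟩ := Polynomial.exists_isRoot_of_monic_of_odd_natDegree
      (LinearMap.charpoly_monic T) (by rwa [LinearMap.charpoly_natDegree])
    rw [← Module.End.hasEigenvalue_iff_isRoot_charpoly] at hr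
    obtain ⟨v, hv⟩ := hr.exists_hasEigenvector
    have hfin : ∀ P : Submodule A M, Module.Finite ℝ P := fun P => Module.Finite.of_injective
      (P.subtype.restrictScalars ℝ) P.injective_subtype
    let S : M →ₗ[A] M := LinearMap.lsmul A M (a - algebraMap ℝ A r)
    have hS : ∀ x, S x = a • x - r • x := fun x => by simp [S]
    have hsum : Module.finrank ℝ (LinearMap.range S) + Module.finrank ℝ (LinearMap.ker S)
        = Module.finrank ℝ M := (S.restrictScalars ℝ).finrank_range_add_finrank_ker
    have hkpos : 0 < Module.finrank ℝ (LinearMap.ker S) := by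
      have : Nontrivial (LinearMap.ker S) := by
        refine ⟨⟨⟨v, ?_⟩, 0, ?_⟩⟩
        · rw [LinearMap.mem_ker, hS, sub_eq_zero]
          exact hv.apply_eq_smul
        · simpa [Subtype.ext_iff] using hv.2
      have := hfin (LinearMap.ker S)
      exact Module.finrank_pos
    have hrpos : 0 < Module.finrank ℝ (LinearMap.range S) := by
      obtain ⟨x, hx⟩ := ha r
      have : Nontrivial (LinearMap.range S) := by
        refine ⟨⟨⟨S x, x, rfl⟩, 0, ?_⟩⟩
        simpa [Subtype.ext_iff, hS, sub_eq_zero] using hx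
      have := hfin (LinearMap.range S)
      exact Module.finrank_pos
    have hsub : ∀ P : Submodule A M, Module.finrank ℝ P < n → Odd (Module.finrank ℝ P) →
        ∃ v : M, v ≠ 0 ∧ ∀ a : A, ∃ r : ℝ, a • v = r • v := by
      intro P hlt hP
      have := hfin P
      obtain ⟨w, hw0, hw⟩ := ih _ hlt hP rfl
      refine ⟨w, by simpa using hw0, fun b => ?_⟩
      obtain ⟨t, ht⟩ := hw b
      exact ⟨t, by simpa using congrArg Subtype.val ht⟩
    rcases Nat.even_or_odd (Module.finrank ℝ (LinearMap.ker S)) with he | ho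
    · refine hsub (LinearMap.range S) (by omega) ?_
      rw [← hsum, Nat.odd_add] at hodd
      exact hodd.mpr he
    · exact hsub (LinearMap.ker S) (by omega) ho

/-! ### Deformations of the system `Xᵢᵈ = 0` -/

theorem MvPolynomial.degree_le_totalDegree {σ R : Type*} [CommRing R] {p : MvPolynomial σ R} {c : σ →₀ ℕ} (hc : c ∈ p.support) :
    c.degree ≤ p.totalDegree :=
  MvPolynomial.le_totalDegree hc

section Deform

variable {ι : Type*} [Fintype ι] {R : Type*} [CommRing R]

/-- The linear endomorphism of `R[X]` that replaces, in each monomial, every full power `Xᵢᵈ` by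
`hᵢ`: it sends `∏ Xᵢ^(cᵢ)` to `∏ Xᵢ^(cᵢ % d) hᵢ^(cᵢ / d)`. If it is bijective, `R[X]` is free over
`R[h]` on the monomials whose exponents are all less than `d`. -/
noncomputable def powSubst (d : ℕ) (h : ι → MvPolynomial ι R) :
    MvPolynomial ι R →ₗ[R] MvPolynomial ι R :=
  (MvPolynomial.basisMonomials ι R).constr R
    (fun c => ∏ i, MvPolynomial.X i ^ (c i % d) * h i ^ (c i / d))

theorem powSubst_monomial (d : ℕ) (h : ι → MvPolynomial ι R) (c : ι →₀ ℕ) :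
    powSubst d h (MvPolynomial.monomial c 1) =
      ∏ i, MvPolynomial.X i ^ (c i % d) * h i ^ (c i / d) := by
  have := (MvPolynomial.basisMonomials ι R).constr_basis R
    (fun c => ∏ i, MvPolynomial.X i ^ (c i % d) * h i ^ (c i / d)) c
  rwa [MvPolynomial.coe_basisMonomials] at this

theorem powSubst_mul_X_pow {d : ℕ} (hd : 0 < d) (h : ι → MvPolynomial ι R) (i : ι)
    (p : MvPolynomial ι R) :
    powSubst d h (p * MvPolynomial.X i ^ d) = h i * powSubst d h p := by
  classical
  suffices H : (powSubst d h) ∘ₗ (LinearMap.mulRight R (MvPolynomial.X i ^ d)) =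
      (LinearMap.mulLeft R (h i)) ∘ₗ powSubst d h from LinearMap.congr_fun H p
  refine (MvPolynomial.basisMonomials ι R).ext fun c => ?_
  simp only [MvPolynomial.coe_basisMonomials, LinearMap.comp_apply, LinearMap.mulRight_apply,
    LinearMap.mulLeft_apply]
  rw [MvPolynomial.X_pow_eq_monomial, MvPolynomial.monomial_mul, one_mul, powSubst_monomial,
    powSubst_monomial, Fintype.prod_eq_mul_prod_compl i, Fintype.prod_eq_mul_prod_compl i]
  have h1 : ∏ j ∈ ({i} : Finset ι)ᶜ, MvPolynomial.X j ^ ((c + Finsupp.single i d) j % d) *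
        h j ^ ((c + Finsupp.single i d) j / d)
      = ∏ j ∈ ({i} : Finset ι)ᶜ, MvPolynomial.X j ^ (c j % d) * h j ^ (c j / d) := by
    refine Finset.prod_congr rfl fun j hj => ?_
    have : i ≠ j := by simpa [eq_comm] using hj
    simp [this]
  rw [h1]
  simp only [Finsupp.add_apply, Finsupp.single_eq_same, Nat.add_mod_right,
    Nat.add_div_right _ hd, pow_succ]
  ring

theorem powSubst_X_pow (d : ℕ) :
    powSubst d (fun i : ι => (MvPolynomial.X i ^ d : MvPolynomial ι R)) = LinearMap.id := by
  refine (MvPolynomial.basisMonomials ι R).ext fun c => ?_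
  simp only [MvPolynomial.coe_basisMonomials, LinearMap.id_apply, powSubst_monomial]
  rw [MvPolynomial.monomial_eq, Finsupp.prod_fintype _ _ (by simp)]
  simp only [map_one, one_mul]
  refine Finset.prod_congr rfl fun i _ => ?_
  rw [← pow_mul, ← pow_add, Nat.mod_add_div]

theorem totalDegree_powSubst_monomial_le {d : ℕ} {h : ι → MvPolynomial ι R}
    (hh : ∀ i, (h i).totalDegree ≤ d) (c : ι →₀ ℕ) :
    (powSubst d h (MvPolynomial.monomial c 1)).totalDegree ≤ c.degree := by
  rw [powSubst_monomial, Finsupp.degree_eq_sum]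
  refine (MvPolynomial.totalDegree_finsetProd _ _).trans (Finset.sum_le_sum fun i _ => ?_)
  refine (MvPolynomial.totalDegree_mul _ _).trans ?_
  have h1 : (MvPolynomial.X i ^ (c i % d) : MvPolynomial ι R).totalDegree ≤ c i % d := by
    rw [MvPolynomial.X_pow_eq_monomial]
    exact (MvPolynomial.totalDegree_monomial_le _ _).trans (by simp)
  have h2 : (h i ^ (c i / d)).totalDegree ≤ (c i / d) * d :=
    (MvPolynomial.totalDegree_pow _ _).trans (Nat.mul_le_mul_left _ (hh i))
  calc _ ≤ c i % d + c i / d * d := add_le_add h1 h2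
    _ = c i := by rw [mul_comm]; exact Nat.mod_add_div _ _

theorem map_powSubst_monomial {S : Type*} [CommRing S] (φ : R →+* S) (d : ℕ)
    (h : ι → MvPolynomial ι R) (c : ι →₀ ℕ) :
    MvPolynomial.map φ (powSubst d h (MvPolynomial.monomial c 1)) =
      powSubst d (fun i => MvPolynomial.map φ (h i)) (MvPolynomial.monomial c 1) := by
  simp [powSubst_monomial, map_prod]

/-- The matrix of `powSubst d h` on the polynomials of degree at most `D`, in the basis of
monomials. -/
noncomputable def powSubstMatrix (d : ℕ) (h : ι → MvPolynomial ι R) (D : ℕ) :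
    Matrix {c : ι →₀ ℕ // c.degree ≤ D} {c : ι →₀ ℕ // c.degree ≤ D} R :=
  Matrix.of fun c' c => (powSubst d h (MvPolynomial.monomial c.1 1)).coeff c'.1

noncomputable instance (D : ℕ) : Fintype {c : ι →₀ ℕ // c.degree ≤ D} :=
  (Finsupp.finite_of_degree_le D).fintype

noncomputable instance (D : ℕ) : DecidableEq {c : ι →₀ ℕ // c.degree ≤ D} :=
  Classical.decEq _

theorem powSubstMatrix_mulVec (d : ℕ) (h : ι → MvPolynomial ι R) {D : ℕ} {p : MvPolynomial ι R}
    (hp : p.totalDegree ≤ D) (c' : {c : ι →₀ ℕ // c.degree ≤ D}) :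
    (powSubstMatrix d h D).mulVec (fun c => p.coeff c.1) c' = (powSubst d h p).coeff c'.1 := by
  have hsupp : p.support ⊆ (Finsupp.finite_of_degree_le (σ := ι) D).toFinset := by
    intro c hc
    have := (MvPolynomial.degree_le_totalDegree hc).trans hp
    exact (Set.Finite.mem_toFinset _).mpr this
  have hexp : p = ∑ c : {c : ι →₀ ℕ // c.degree ≤ D},
      p.coeff c.1 • MvPolynomial.monomial c.1 (1 : R) := by
    conv_lhs => rw [p.as_sum]
    rw [Finset.sum_subset hsupp (fun c _ hc => by
      rw [MvPolynomial.notMem_support_iff.mp hc, MvPolynomial.monomial_zero])]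
    rw [Finset.sum_subtype _ (p := fun c : ι →₀ ℕ => c.degree ≤ D) (by simp)]
    refine Finset.sum_congr rfl fun c _ => ?_
    rw [MvPolynomial.smul_monomial, smul_eq_mul, mul_one]
  conv_rhs => rw [hexp]
  simp only [map_sum, map_smul, MvPolynomial.coeff_sum, MvPolynomial.coeff_smul, Matrix.mulVec,
    dotProduct, powSubstMatrix, Matrix.of_apply, smul_eq_mul]
  exact Finset.sum_congr rfl fun c _ => mul_comm _ _

theorem totalDegree_powSubst_le {d : ℕ} {h : ι → MvPolynomial ι R}
    (hh : ∀ i, (h i).totalDegree ≤ d) (p : MvPolynomial ι R) :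
    (powSubst d h p).totalDegree ≤ p.totalDegree := by
  conv_lhs => rw [p.as_sum]
  rw [map_sum]
  refine MvPolynomial.totalDegree_finsetSum_le fun c hc => ?_
  have : MvPolynomial.monomial c (p.coeff c) = p.coeff c • MvPolynomial.monomial c (1 : R) := by
    rw [MvPolynomial.smul_monomial, smul_eq_mul, mul_one]
  rw [this, map_smul]
  refine (MvPolynomial.totalDegree_smul_le _ _).trans
    ((totalDegree_powSubst_monomial_le hh c).trans ?_)
  exact MvPolynomial.degree_le_totalDegree hc

end Deform

section Real

variable {ι : Type*} [Fintype ι]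

theorem powSubst_bijective_of_det_ne_zero {d : ℕ} {h : ι → MvPolynomial ι ℝ}
    (hh : ∀ i, (h i).totalDegree ≤ d) (hdet : ∀ D, (powSubstMatrix d h D).det ≠ 0) :
    Function.Bijective (powSubst d h) := by
  have hinj : Function.Injective (powSubst d h) := by
    rw [injective_iff_map_eq_zero]
    intro p hp
    have h0 := Matrix.eq_zero_of_mulVec_eq_zero (hdet p.totalDegree)
      (v := fun c => p.coeff c.1) (by
        ext c'
        rw [powSubstMatrix_mulVec d h le_rfl, hp]; simp)
    ext c
    by_cases hc : c ∈ p.support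
    · simpa using congrFun h0 ⟨c, MvPolynomial.degree_le_totalDegree hc⟩
    · simpa using hc
  refine ⟨hinj, fun q => ?_⟩
  let V := MvPolynomial.restrictTotalDegree ι ℝ q.totalDegree
  have hV : ∀ p ∈ V, powSubst d h p ∈ V := fun p hp => by
    rw [MvPolynomial.mem_restrictTotalDegree] at hp ⊢
    exact (totalDegree_powSubst_le hh p).trans hp
  have hs : Function.Surjective ((powSubst d h).restrict hV) := by
    rw [← LinearMap.injective_iff_surjective]
    intro a b hab
    exact Subtype.ext (hinj (by simpa [Subtype.ext_iff] using hab))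
  obtain ⟨p, hp⟩ := hs ⟨q, by rw [MvPolynomial.mem_restrictTotalDegree]⟩
  exact ⟨p, by simpa [Subtype.ext_iff] using hp⟩

/-- For all but countably many `s`, replacing the powers `Xᵢᵈ` by `Xᵢᵈ + s gᵢ` is bijective: on the
polynomials of degree at most `D` its determinant is a polynomial in `s` with value `1` at `0`. -/
theorem countable_not_bijective_powSubst {d : ℕ} {g : ι → MvPolynomial ι ℝ}
    (hg : ∀ i, (g i).totalDegree ≤ d) :
    {s : ℝ | ¬ Function.Bijective
      (powSubst d fun i => MvPolynomial.X i ^ d + MvPolynomial.C s * g i)}.Countable := by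
  classical
  let H : ι → MvPolynomial ι (Polynomial ℝ) := fun i =>
    MvPolynomial.X i ^ d + MvPolynomial.C Polynomial.X * MvPolynomial.map Polynomial.C (g i)
  have hH : ∀ s : ℝ, (fun i => MvPolynomial.map (Polynomial.evalRingHom s) (H i)) =
      fun i => MvPolynomial.X i ^ d + MvPolynomial.C s * g i := by
    intro s
    funext i
    simp only [H, map_add, map_pow, map_mul, MvPolynomial.map_X, MvPolynomial.map_C,
      MvPolynomial.map_map]
    have : (Polynomial.evalRingHom s).comp Polynomial.C = RingHom.id ℝ := by ext; simp
    rw [this, MvPolynomial.map_id]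
    simp
  have hdet : ∀ (s : ℝ) (D : ℕ), (powSubstMatrix d
      (fun i => MvPolynomial.X i ^ d + MvPolynomial.C s * g i) D).det =
      (powSubstMatrix d H D).det.eval s := by
    intro s D
    rw [← Polynomial.coe_evalRingHom, RingHom.map_det]
    congr 1
    ext c' c
    rw [RingHom.mapMatrix_apply, Matrix.map_apply]
    simp only [powSubstMatrix, Matrix.of_apply]
    rw [← MvPolynomial.coeff_map, map_powSubst_monomial, hH]
  have hne : ∀ D : ℕ, (powSubstMatrix d H D).det ≠ 0 := by
    intro D h0
    have h1 := hdet 0 D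
    rw [h0, Polynomial.eval_zero] at h1
    have h2 : powSubstMatrix d (fun i => MvPolynomial.X i ^ d + MvPolynomial.C (0 : ℝ) * g i) D
        = 1 := by
      ext c' c
      simp only [map_zero, zero_mul, add_zero, powSubstMatrix, powSubst_X_pow, Matrix.of_apply,
        LinearMap.id_apply]
      rw [MvPolynomial.coeff_monomial]
      by_cases hc : c' = c
      · rw [hc, if_pos rfl, Matrix.one_apply_eq]
      · rw [Matrix.one_apply_ne hc, if_neg fun h => hc (Subtype.ext h.symm)]
    rw [h2, Matrix.det_one] at h1
    exact one_ne_zero h1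
  have hdeg : ∀ (s : ℝ) i, (MvPolynomial.X i ^ d + MvPolynomial.C s * g i).totalDegree ≤ d := by
    intro s i
    refine (MvPolynomial.totalDegree_add _ _).trans (max_le ?_ ?_)
    · rw [MvPolynomial.totalDegree_X_pow]
    · refine (MvPolynomial.totalDegree_mul _ _).trans ?_
      simpa using hg i
  refine Set.Countable.mono (s₂ := ⋃ D : ℕ, {s | (powSubstMatrix d H D).det.IsRoot s}) ?_ ?_
  · intro s hs
    by_contra hcon
    simp only [mem_iUnion, mem_ofPred_eq, not_exists, Polynomial.IsRoot.def] at hcon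
    exact hs (powSubst_bijective_of_det_ne_zero (hdeg s) fun D => by
      rw [hdet]; exact hcon D)
  · exact Set.countable_iUnion fun D => (Polynomial.finite_setOfPred_isRoot (hne D)).countable

/-- If `powSubst d h` is bijective and `d` is odd, then `h = 0` has a real solution: the quotient of
the polynomial ring by the `hᵢ` has the odd dimension `d ^ |ι|`, and a common eigenvector of the
multiplications by the variables yields the solution. -/
theorem exists_common_zero_of_powSubst_bijective {d : ℕ} (hd : Odd d) {h : ι → MvPolynomial ι ℝ}
    (hb : Function.Bijective (powSubst d h)) :
    ∃ x : ι → ℝ, ∀ i, MvPolynomial.eval x (h i) = 0 := by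
  classical
  let e := LinearEquiv.ofBijective (powSubst d h) hb
  let I : Ideal (MvPolynomial ι ℝ) := Ideal.span (Set.range h)
  let χ : MvPolynomial ι ℝ →ₗ[ℝ] ((ι → Fin d) → ℝ) :=
    (LinearMap.pi fun σ : ι → Fin d => (MvPolynomial.lcoeff ℝ
      (Finsupp.equivFunOnFinite.symm fun i => (σ i : ℕ)))) ∘ₗ e.symm.toLinearMap
  have hχ : ∀ p σ, χ (powSubst d h p) σ =
      p.coeff (Finsupp.equivFunOnFinite.symm fun i => (σ i : ℕ)) := by
    intro p σ
    have : e.symm (powSubst d h p) = p := e.symm_apply_apply p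
    simp [χ, this, MvPolynomial.lcoeff]
  have hker : LinearMap.ker χ = I.restrictScalars ℝ := by
    ext q
    obtain ⟨p, rfl⟩ := hb.2 q
    rw [LinearMap.mem_ker, Submodule.restrictScalars_mem]
    constructor
    · intro h0
      rw [p.as_sum, map_sum]
      refine Ideal.sum_mem _ fun c hc => ?_
      have hex : ∃ i, d ≤ c i := by
        by_contra! hlt
        have := hχ p fun i => ⟨c i, hlt i⟩
        rw [h0] at this
        have h2 : (Finsupp.equivFunOnFinite.symm fun i => c i) = c := by ext; simp
        simp only [Pi.zero_apply, h2] at this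
        exact MvPolynomial.mem_support_iff.mp hc this.symm
      obtain ⟨i, hi⟩ := hex
      have : MvPolynomial.monomial c (p.coeff c) =
          MvPolynomial.monomial (c - Finsupp.single i d) (p.coeff c) * MvPolynomial.X i ^ d := by
        rw [MvPolynomial.X_pow_eq_monomial, MvPolynomial.monomial_mul, mul_one,
          tsub_add_cancel_of_le (by simpa using hi)]
      rw [this, powSubst_mul_X_pow hd.pos]
      exact Ideal.mul_mem_right _ _ (Ideal.subset_span ⟨i, rfl⟩)
    · intro hI
      obtain ⟨a, ha⟩ := Ideal.mem_span_range_iff_exists_fun.mp hI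
      rw [← ha, map_sum]
      refine Finset.sum_eq_zero fun i _ => ?_
      obtain ⟨b, hb'⟩ := hb.2 (a i)
      rw [← hb', mul_comm, ← powSubst_mul_X_pow hd.pos]
      ext σ
      rw [hχ, MvPolynomial.X_pow_eq_monomial, MvPolynomial.coeff_mul_monomial', if_neg]
      · rfl
      · simp
  have hsurj : Function.Surjective χ := by
    intro y
    refine ⟨powSubst d h (∑ σ : ι → Fin d, MvPolynomial.monomial
      (Finsupp.equivFunOnFinite.symm fun i => (σ i : ℕ)) (y σ)), ?_⟩
    ext σ
    rw [hχ, MvPolynomial.coeff_sum, Finset.sum_eq_single σ]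
    · simp
    · intro τ _ hτ
      rw [MvPolynomial.coeff_monomial, if_neg]
      intro heq
      apply hτ
      ext i
      simpa using congrArg (fun f => f i) heq
    · simp
  let A := MvPolynomial ι ℝ ⧸ I
  let E : A ≃ₗ[ℝ] ((ι → Fin d) → ℝ) :=
    (Submodule.Quotient.restrictScalarsEquiv ℝ I).symm ≪≫ₗ
      (Submodule.quotEquivOfEq _ _ hker.symm ≪≫ₗ χ.quotKerEquivOfSurjective hsurj)
  have hfin : Module.Finite ℝ A := Module.Finite.equiv E.symm
  have hodd : Odd (Module.finrank ℝ A) := by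
    rw [E.finrank_eq]
    simpa using hd.pow
  obtain ⟨v, hv0, hv⟩ := exists_common_eigenvector (A := MvPolynomial ι ℝ) (M := A) hodd
  choose x hx using fun i => hv (MvPolynomial.X i)
  have key : ∀ p : MvPolynomial ι ℝ, p • v = MvPolynomial.eval x p • v := by
    intro p
    induction p using MvPolynomial.induction_on with
    | C a => rw [MvPolynomial.eval_C, ← MvPolynomial.algebraMap_eq, algebraMap_smul]
    | add p q hp hq => rw [add_smul, hp, hq, map_add, add_smul]
    | mul_X p i hp =>
      rw [mul_smul, hx, smul_comm, hp, map_mul, MvPolynomial.eval_X, smul_smul, mul_comm]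
  refine ⟨x, fun i => ?_⟩
  have h0 : h i • v = 0 := by
    obtain ⟨w, rfl⟩ := Ideal.Quotient.mk_surjective v
    change (Ideal.Quotient.mk I) (h i * w) = 0
    exact Ideal.Quotient.eq_zero_iff_mem.mpr
      (Ideal.mul_mem_right _ _ (Ideal.subset_span ⟨i, rfl⟩))
  rw [key] at h0
  exact (smul_eq_zero.mp h0).resolve_right hv0

end Real

/-! ### The Borsuk–Ulam theorem -/

section BorsukUlam

theorem MvPolynomial.IsHomogeneous.eval_smul {σ R : Type*} [Fintype σ] [CommRing R]
    {p : MvPolynomial σ R} {d : ℕ} (hp : p.IsHomogeneous d) (r : R) (x : σ → R) :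
    MvPolynomial.eval (r • x) p = r ^ d * MvPolynomial.eval x p := by
  rw [MvPolynomial.eval_eq', MvPolynomial.eval_eq', Finset.mul_sum]
  refine Finset.sum_congr rfl fun c hc => ?_
  have hdeg : ∑ i, c i = d := by
    rw [← Finsupp.degree_eq_sum]
    by_contra h
    exact MvPolynomial.mem_support_iff.mp hc (hp.coeff_eq_zero h)
  simp only [Pi.smul_apply, smul_eq_mul, mul_pow, Finset.prod_mul_distrib, Finset.prod_pow_eq_pow_sum,
    hdeg]
  ring

variable {ι : Type*} [Fintype ι]

/-- The Euclidean unit sphere of `ℝ × ℝ^ι`, as a set of functions on `Option ι`. -/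
def optionSphere (ι : Type*) [Fintype ι] : Set (Option ι → ℝ) := {x | ∑ o, x o ^ 2 = 1}

theorem isCompact_optionSphere : IsCompact (optionSphere ι) := by
  refine Metric.isCompact_of_isClosed_isBounded
    (isClosed_eq (by fun_prop) continuous_const) ?_
  refine (Metric.isBounded_closedBall (x := (0 : Option ι → ℝ)) (r := 1)).subset fun x hx => ?_
  rw [mem_closedBall_zero_iff, pi_norm_le_iff_of_nonneg zero_le_one]
  intro o
  have h1 : x o ^ 2 ≤ ∑ o, x o ^ 2 :=
    Finset.single_le_sum (f := fun o => x o ^ 2) (fun _ _ => sq_nonneg _) (Finset.mem_univ o)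
  rw [show ∑ o, x o ^ 2 = 1 from hx] at h1
  rw [Real.norm_eq_abs]
  exact abs_le_one_iff_mul_self_le_one.mpr (by nlinarith)

/-- Forms of a common odd degree, one fewer than the number of variables, take arbitrarily small
values simultaneously on the unit sphere: on the affine chart where the first variable is `1`,
the perturbed system `Xᵢᵈ + s gᵢ = 0` has a real solution for arbitrarily large `s`. -/
theorem exists_mem_optionSphere_abs_eval_le {d : ℕ} (hd : Odd d)
    {Q : ι → MvPolynomial (Option ι) ℝ} (hQ : ∀ i, (Q i).IsHomogeneous d) {ε : ℝ} (hε : 0 < ε) :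
    ∃ x ∈ optionSphere ι, ∀ i, |MvPolynomial.eval x (Q i)| ≤ ε := by
  let v : Option ι → MvPolynomial ι ℝ := fun o => o.elim 1 MvPolynomial.X
  have hv : ∀ o, (v o).totalDegree ≤ 1 := by
    rintro (_ | i)
    · simp [v]
    · simp [v]
  let g : ι → MvPolynomial ι ℝ := fun i => MvPolynomial.aeval v (Q i)
  have hg : ∀ i, (g i).totalDegree ≤ d := by
    intro i
    simp only [g]
    rw [MvPolynomial.aeval_def, MvPolynomial.eval₂_eq']
    refine MvPolynomial.totalDegree_finsetSum_le fun c hc => ?_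
    refine (MvPolynomial.totalDegree_mul _ _).trans ?_
    rw [MvPolynomial.algebraMap_eq, MvPolynomial.totalDegree_C, zero_add]
    calc _ ≤ ∑ o, (v o ^ c o).totalDegree := MvPolynomial.totalDegree_finsetProd _ _
      _ ≤ ∑ o, c o := Finset.sum_le_sum fun o _ => (MvPolynomial.totalDegree_pow _ _).trans
          (by simpa using Nat.mul_le_mul_left (c o) (hv o))
      _ = c.degree := (Finsupp.degree_eq_sum c).symm
      _ ≤ d := by
        by_contra h
        exact MvPolynomial.mem_support_iff.mp hc ((hQ i).coeff_eq_zero (by omega))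
  obtain ⟨s, hs, hsb⟩ : ∃ s ∈ Ioi ε⁻¹, s ∉ {s : ℝ | ¬ Function.Bijective
      (powSubst d fun i => MvPolynomial.X i ^ d + MvPolynomial.C s * g i)} := by
    by_contra! hcon
    have hc : (Ioi ε⁻¹).Countable := (countable_not_bijective_powSubst hg).mono hcon
    rw [← Cardinal.le_aleph0_iff_set_countable, Cardinal.mk_Ioi_real] at hc
    exact absurd hc (not_le.mpr Cardinal.aleph0_lt_continuum)
  obtain ⟨y, hy⟩ := exists_common_zero_of_powSubst_bijective hd (not_not.mp hsb)
  have hs0 : 0 < s := (inv_pos.mpr hε).trans hs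
  let p : Option ι → ℝ := fun o => o.elim 1 y
  have hgp : ∀ i, MvPolynomial.eval y (g i) = MvPolynomial.eval p (Q i) := by
    intro i
    simp only [g]
    rw [MvPolynomial.aeval_def, MvPolynomial.eval₂_eq', map_sum, MvPolynomial.eval_eq']
    refine Finset.sum_congr rfl fun c _ => ?_
    rw [map_mul, map_prod, MvPolynomial.algebraMap_eq, MvPolynomial.eval_C]
    congr 1
    refine Finset.prod_congr rfl fun o _ => ?_
    rw [map_pow]
    cases o <;> simp [v, p]
  have hsum : ∑ o, p o ^ 2 = 1 + ∑ i, y i ^ 2 := by simp [Fintype.sum_option, p]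
  have hpos : 0 < ∑ o, p o ^ 2 := by
    rw [hsum]; positivity
  set r := Real.sqrt (∑ o, p o ^ 2) with hr
  have hrpos : 0 < r := Real.sqrt_pos.mpr hpos
  have hrsq : r ^ 2 = ∑ o, p o ^ 2 := Real.sq_sqrt hpos.le
  refine ⟨r⁻¹ • p, ?_, fun i => ?_⟩
  · simp only [optionSphere, mem_ofPred_eq, Pi.smul_apply, smul_eq_mul, mul_pow]
    rw [← Finset.mul_sum, ← hrsq, inv_pow, inv_mul_cancel₀ (by positivity)]
  · rw [(hQ i).eval_smul]
    have h1 := hy i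
    simp only [map_add, map_pow, map_mul, MvPolynomial.eval_X, MvPolynomial.eval_C] at h1
    rw [hgp] at h1
    have h2 : MvPolynomial.eval p (Q i) = -(s⁻¹ * y i ^ d) := by
      field_simp
      linarith
    have hyr : |y i| ≤ r := by
      refine Real.abs_le_sqrt ?_
      rw [hsum]
      have := Finset.single_le_sum (f := fun i => y i ^ 2) (fun _ _ => sq_nonneg _)
        (Finset.mem_univ i)
      linarith
    rw [h2, mul_neg, abs_neg, abs_mul, abs_mul, abs_pow, abs_pow, abs_of_pos (inv_pos.mpr hrpos),
      abs_of_pos (inv_pos.mpr hs0)]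
    have h3 : |y i| ^ d ≤ r ^ d := pow_le_pow_left₀ (abs_nonneg _) hyr d
    calc r⁻¹ ^ d * (s⁻¹ * |y i| ^ d) ≤ r⁻¹ ^ d * (s⁻¹ * r ^ d) := by gcongr
      _ = s⁻¹ := by
        rw [inv_pow]; field_simp
      _ ≤ ε := inv_le_of_inv_le₀ hε (le_of_lt hs)

/-- The form of odd degree `D` that agrees on the unit sphere with the odd part of `P`: each monomial
of odd degree is completed by a power of the squared norm. -/
noncomputable def oddForm {σ : Type*} [Fintype σ] (D : ℕ) (P : MvPolynomial σ ℝ) :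
    MvPolynomial σ ℝ :=
  ∑ c ∈ P.support with Odd c.degree,
    MvPolynomial.monomial c (P.coeff c) * (∑ o, MvPolynomial.X o ^ 2) ^ ((D - c.degree) / 2)

theorem isHomogeneous_oddForm {σ : Type*} [Fintype σ] {D : ℕ} (hD : Odd D)
    {P : MvPolynomial σ ℝ} (hP : P.totalDegree ≤ D) : (oddForm D P).IsHomogeneous D := by
  refine MvPolynomial.IsHomogeneous.sum _ _ _ fun c hc => ?_
  rw [Finset.mem_filter] at hc
  have hle : c.degree ≤ D := (MvPolynomial.degree_le_totalDegree hc.1).trans hP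
  have h1 : (MvPolynomial.monomial c (P.coeff c)).IsHomogeneous c.degree :=
    MvPolynomial.isHomogeneous_monomial _ rfl
  have h2 : (∑ o : σ, (MvPolynomial.X o ^ 2 : MvPolynomial σ ℝ)).IsHomogeneous 2 :=
    MvPolynomial.IsHomogeneous.sum _ _ _ fun o _ => MvPolynomial.isHomogeneous_X_pow o 2
  have h3 := h1.mul (h2.pow ((D - c.degree) / 2))
  have h4 : c.degree + 2 * ((D - c.degree) / 2) = D := by
    have := Nat.Odd.sub_odd hD hc.2
    rw [Nat.two_mul_div_two_of_even this]; omega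
  rwa [h4] at h3

theorem eval_oddForm {σ : Type*} [Fintype σ] (D : ℕ) (P : MvPolynomial σ ℝ) {x : σ → ℝ}
    (hx : ∑ o, x o ^ 2 = 1) :
    MvPolynomial.eval x (oddForm D P) =
      (MvPolynomial.eval x P - MvPolynomial.eval (-x) P) / 2 := by
  rw [MvPolynomial.eval_eq' x P, MvPolynomial.eval_eq' (-x) P, ← Finset.sum_sub_distrib,
    Finset.sum_div, oddForm, map_sum, Finset.sum_filter]
  refine Finset.sum_congr rfl fun c _ => ?_
  have hneg : ∏ o, (-x) o ^ c o = (-1) ^ c.degree * ∏ o, x o ^ c o := by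
    rw [Finsupp.degree_eq_sum, ← Finset.prod_pow_eq_pow_sum, ← Finset.prod_mul_distrib]
    refine Finset.prod_congr rfl fun o _ => ?_
    rw [← mul_pow]; simp
  have hmon : MvPolynomial.eval x (MvPolynomial.monomial c (P.coeff c)) =
      P.coeff c * ∏ o, x o ^ c o := by
    rw [MvPolynomial.eval_monomial, Finsupp.prod_fintype _ _ (by simp)]
  rw [hneg]
  split_ifs with h
  · simp only [map_mul, map_pow, map_sum, MvPolynomial.eval_X, hx, one_pow, mul_one, hmon,
      h.neg_one_pow]
    ring
  · rw [(Nat.not_odd_iff_even.mp h).neg_one_pow]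
    ring

theorem exists_mvPolynomial_near {σ : Type*} {K : Set (σ → ℝ)} (hK : IsCompact K)
    {f : (σ → ℝ) → ℝ} (hf : ContinuousOn f K) {ε : ℝ} (hε : 0 < ε) :
    ∃ P : MvPolynomial σ ℝ, ∀ x ∈ K, |MvPolynomial.eval x P - f x| < ε := by
  have : CompactSpace K := isCompact_iff_compactSpace.mp hK
  let coord : σ → C(K, ℝ) := fun o => 
    ⟨fun x => x.1 o, (continuous_apply o).comp continuous_subtype_val⟩
  let A : Subalgebra ℝ C(K, ℝ) := (MvPolynomial.aeval coord).range
  have hA : A.SeparatesPoints := by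
    intro x y hxy
    obtain ⟨o, ho⟩ : ∃ o, x.1 o ≠ y.1 o := by
      by_contra! h
      exact hxy (Subtype.ext (funext h))
    exact ⟨coord o, ⟨coord o, ⟨MvPolynomial.X o, by simp⟩, rfl⟩, ho⟩
  obtain ⟨⟨g, P, rfl⟩, hg⟩ :=
    ContinuousMap.exists_mem_subalgebra_near_continuousMap_of_separatesPoints A hA
      ⟨K.domRestrict f, hf.domRestrict⟩ ε hε
  refine ⟨P, fun x hx => ?_⟩
  have h1 := (ContinuousMap.norm_lt_iff _ hε).mp hg ⟨x, hx⟩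
  have h2 : (MvPolynomial.aeval coord P) ⟨x, hx⟩ = MvPolynomial.eval x P := by
    have : ((ContinuousMap.evalAlgHom ℝ ℝ (⟨x, hx⟩ : K)).comp (MvPolynomial.aeval coord)) =
        MvPolynomial.aeval x := by
      ext o
      simp [coord]
    simpa using DFunLike.congr_fun this P
  rw [← h2]
  exact h1

/-- **Borsuk–Ulam theorem**: an odd continuous map from `ℝ × ℝ^ι` minus the origin to `ℝ^ι` has a
zero. -/
theorem borsuk_ulam_option {f : (Option ι → ℝ) → ι → ℝ} (hf : ContinuousOn f {0}ᶜ)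
    (hodd : ∀ x, x ≠ 0 → f (-x) = -f x) : ∃ x, x ≠ 0 ∧ f x = 0 := by
  have hne : ∀ x ∈ optionSphere ι, x ≠ 0 := by
    rintro x hx rfl
    simp [optionSphere] at hx
  have hfK : ContinuousOn f (optionSphere ι) := hf.mono fun x hx => hne x hx
  have hnonempty : (optionSphere ι).Nonempty := by
    classical
    refine ⟨Pi.single none 1, ?_⟩
    simp [optionSphere, Fintype.sum_option]
  obtain ⟨x₀, hx₀, hmin⟩ := isCompact_optionSphere.exists_isMinOn hnonempty hfK.norm
  refine ⟨x₀, hne x₀ hx₀, ?_⟩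
  by_contra hzero
  have hδ : 0 < ‖f x₀‖ := norm_pos_iff.mpr hzero
  set δ := ‖f x₀‖
  choose P hP using fun i => exists_mvPolynomial_near (isCompact_optionSphere (ι := ι))
    (f := fun x => f x i) ((continuous_apply i).comp_continuousOn hfK) (half_pos hδ)
  let D := 2 * (∑ i, (P i).totalDegree) + 1
  have hD : ∀ i, (P i).totalDegree ≤ D := fun i => by
    have := Finset.single_le_sum (f := fun i => (P i).totalDegree) (fun _ _ => Nat.zero_le _)
      (Finset.mem_univ i)
    simp only [D]
    omega
  obtain ⟨x, hx, hsmall⟩ := exists_mem_optionSphere_abs_eval_le (d := D) ⟨_, rfl⟩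
    (fun i => isHomogeneous_oddForm ⟨_, rfl⟩ (hD i)) (show 0 < δ / 4 by positivity)
  have hx' : -x ∈ optionSphere ι := by simpa [optionSphere] using hx
  have hlt : ‖f x‖ < δ := by
    rw [pi_norm_lt_iff hδ]
    intro i
    have h1 := hsmall i
    rw [eval_oddForm D (P i) hx] at h1
    have h2 := hP i x hx
    have h3 := hP i (-x) hx'
    rw [hodd x (hne x hx)] at h3
    simp only [Pi.neg_apply] at h3
    rw [Real.norm_eq_abs, abs_lt]
    rw [abs_le] at h1
    rw [abs_lt] at h2 h3
    constructor <;> linarith [h1.1, h1.2, h2.1, h2.2, h3.1, h3.2]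
  exact absurd (isMinOn_iff.mp hmin x hx) (not_le.mpr hlt)

/-- **Borsuk–Ulam theorem** for maps into a space of smaller dimension. -/
theorem borsuk_ulam {E : Type*} [NormedAddCommGroup E] [NormedSpace ℝ E] [FiniteDimensional ℝ E]
    (hcard : Fintype.card ι < Module.finrank ℝ E) {f : E → ι → ℝ} (hf : ContinuousOn f {0}ᶜ)
    (hodd : ∀ x, x ≠ 0 → f (-x) = -f x) : ∃ x, x ≠ 0 ∧ f x = 0 := by
  obtain ⟨j, hj⟩ : ∃ j : (Option ι → ℝ) →ₗ[ℝ] E, Function.Injective j := by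
    obtain ⟨e⟩ : Nonempty (Option ι ↪ Fin (Module.finrank ℝ E)) :=
      Function.Embedding.nonempty_of_card_le (by simpa using hcard)
    exact ⟨Fintype.linearCombination ℝ _, linearIndependent_iff_injective_fintypeLinearCombination.mp
      ((Module.finBasis ℝ E).linearIndependent.comp e e.injective)⟩
  have hj0 : ∀ x, x ≠ 0 → j x ≠ 0 := fun x hx => by
    rwa [Ne, map_eq_zero_iff j hj]
  obtain ⟨x, hx0, hx⟩ := borsuk_ulam_option (f := fun x => f (j x))
    (hf.comp j.continuous_of_finiteDimensional.continuousOn fun x hx => hj0 x hx)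
    (fun x hx => by rw [map_neg, hodd _ (hj0 x hx)])
  exact ⟨j x, hj0 x hx0, hx⟩

end BorsukUlam

/-! ### Infinitesimal invariance -/

section Infinitesimal

/-- `w` is infinitesimally invariant on `U` under the linear vector field `x ↦ X x`: the derivative
of `w` along that field vanishes on `U`. -/
def InfInvariantOn {E F : Type*} [NormedAddCommGroup E] [NormedSpace ℝ E] [NormedAddCommGroup F]
    [NormedSpace ℝ F] (w : E → F) (U : Set E) (X : E →L[ℝ] E) : Prop :=
  ∀ x ∈ U, fderiv ℝ w x (X x) = 0

section Bracket

variable {E F : Type*} [NormedAddCommGroup E] [NormedSpace ℝ E] [CompleteSpace E]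
  [NormedAddCommGroup F] [NormedSpace ℝ F]

open Filter Topology in
/-- Infinitesimal invariance passes to commutators. No second derivative of `w` is needed:
invariance under `X` makes `w` locally invariant under the flow `exp (t X)`, which therefore
transports the invariance under `Y` at `exp (t X) x` to the invariance at `x` under the conjugate
`exp (-t X) Y exp (t X)`, and this is differentiated at `t = 0`. -/
theorem InfInvariantOn.commutator {w : E → F} {U : Set E} (hU : IsOpen U)
    (hw : DifferentiableOn ℝ w U) {X Y : E →L[ℝ] E} (hX : InfInvariantOn w U X)
    (hY : InfInvariantOn w U Y) : InfInvariantOn w U (X * Y - Y * X) := by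
  intro x hx
  let φ : ℝ → (E →L[ℝ] E) := fun t => NormedSpace.exp (t • X)
  have hφ : ∀ t, HasDerivAt φ (X * φ t) t := fun t => hasDerivAt_exp_smul_const' X t
  have hφc : Continuous φ := continuous_iff_continuousAt.mpr fun t => (hφ t).continuousAt
  have hφ0 : φ 0 = 1 := by simp [φ]
  have hφneg : ∀ t, φ t * φ (-t) = 1 := by
    intro t
    have : Commute (t • X) ((-t) • X) := (Commute.refl X).smul_left _ |>.smul_right _
    simp only [φ]
    let _ : NormedAlgebra ℚ (E →L[ℝ] E) := NormedAlgebra.restrictScalars ℚ ℝ _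
    rw [← NormedSpace.exp_add_of_commute this]
    simp
  have hcont : Continuous fun p : ℝ × E => φ p.1 p.2 := by fun_prop
  have hmem : ∀ᶠ p : ℝ × E in 𝓝 (0, x), φ p.1 p.2 ∈ U := by
    refine hcont.continuousAt.eventually_mem (hU.mem_nhds ?_)
    simpa [hφ0] using hx
  rw [nhds_prod_eq, Filter.eventually_prod_iff] at hmem
  obtain ⟨pa, hpa, pb, hpb, hab⟩ := hmem
  obtain ⟨ε, hε, hεa⟩ := Metric.eventually_nhds_iff_ball.mp hpa
  have hconst : ∀ t ∈ Metric.ball (0 : ℝ) ε, ∀ y, pb y → w (φ t y) = w y := by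
    intro t ht y hy
    have hderiv : ∀ s ∈ Metric.ball (0 : ℝ) ε, HasDerivAt (fun s => w (φ s y)) 0 s := by
      intro s hs
      have hsU : φ s y ∈ U := hab (hεa s hs) hy
      have h1 : HasDerivAt (fun s => φ s y) (X (φ s y)) s := by
        simpa using (hφ s).clm_apply (hasDerivAt_const s y)
      have h2 := ((hw.differentiableAt (hU.mem_nhds hsU)).hasFDerivAt).comp_hasDerivAt s h1
      rwa [hX _ hsU] at h2
    have h3 := (convex_ball (0 : ℝ) ε).is_const_of_fderivWithin_eq_zero (𝕜 := ℝ)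
      (f := fun s => w (φ s y))
      (fun s hs => (hderiv s hs).differentiableAt.differentiableWithinAt)
      (fun s hs => by
        rw [fderivWithin_of_isOpen Metric.isOpen_ball hs]
        ext
        simp [(hderiv s hs).deriv])
      ht (Metric.mem_ball_self hε)
    simpa [hφ0] using h3
  have hzero : ∀ t ∈ Metric.ball (0 : ℝ) ε, fderiv ℝ w x (φ (-t) (Y (φ t x))) = 0 := by
    intro t ht
    have hpx : pb x := hpb.self_of_nhds
    have htU : φ t x ∈ U := hab (hεa t ht) hpx
    have h1 : (fun y => w (φ t y)) =ᶠ[𝓝 x] w := hpb.mono fun y hy => hconst t ht y hy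
    have h2 := ((hw.differentiableAt (hU.mem_nhds htU)).hasFDerivAt).comp x
      (φ t).hasFDerivAt
    have h3 : fderiv ℝ w x = (fderiv ℝ w (φ t x)).comp (φ t) := by
      rw [← h1.fderiv_eq]
      exact h2.fderiv
    rw [h3, ContinuousLinearMap.comp_apply]
    have h4 : φ t (φ (-t) (Y (φ t x))) = Y (φ t x) := by
      have := DFunLike.congr_fun (hφneg t) (Y (φ t x))
      simpa using this
    rw [h4]
    exact hY _ htU
  have hd : HasDerivAt (fun t => fderiv ℝ w x (φ (-t) (Y (φ t x))))
      (fderiv ℝ w x (-(X (Y x)) + Y (X x))) 0 := by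
    have h1 : HasDerivAt (fun t => φ (-t)) (-X) 0 := by
      have := (hφ (-0)).scomp (0 : ℝ) (hasDerivAt_neg (0 : ℝ))
      simpa [hφ0, Function.comp_def] using this
    have h2 : HasDerivAt (fun t => Y (φ t x)) (Y (X x)) 0 := by
      have : HasDerivAt (fun t => φ t x) (X x) 0 := by
        simpa [hφ0] using (hφ 0).clm_apply (hasDerivAt_const (0 : ℝ) x)
      exact Y.hasFDerivAt.comp_hasDerivAt 0 this
    have h3 := h1.clm_apply h2
    have h4 := (fderiv ℝ w x).hasFDerivAt.comp_hasDerivAt (0 : ℝ) h3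
    simpa [hφ0, Function.comp_def] using h4
  have hd0 : HasDerivAt (fun t => fderiv ℝ w x (φ (-t) (Y (φ t x)))) 0 0 :=
    (hasDerivAt_const (0 : ℝ) (0 : F)).congr_of_eventuallyEq
      (Filter.eventually_of_mem (Metric.ball_mem_nhds 0 hε) hzero)
  have h5 := hd.unique hd0
  simp only [sub_apply, mul_apply_eq_comp]
  rw [show X (Y x) - Y (X x) = -(-(X (Y x)) + Y (X x)) by abel, map_neg, h5, neg_zero]

end Bracket

variable {E F : Type*} [NormedAddCommGroup E] [InnerProductSpace ℝ E]
  [NormedAddCommGroup F] [NormedSpace ℝ F]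

/-- The infinitesimal rotation `a ∧ b` in the plane of `a` and `b`, the field
`x ↦ ⟨a, x⟩ b - ⟨b, x⟩ a`. -/
noncomputable def rotGen (a b : E) : E →L[ℝ] E :=
  (innerSL ℝ a).smulRight b - (innerSL ℝ b).smulRight a

theorem rotGen_apply (a b x : E) : rotGen a b x = inner ℝ a x • b - inner ℝ b x • a := by
  simp [rotGen]

theorem InfInvariantOn.mono {w : E → F} {U V : Set E} {X : E →L[ℝ] E}
    (h : InfInvariantOn w U X) (hVU : V ⊆ U) : InfInvariantOn w V X :=
  fun x hx => h x (hVU hx)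

theorem infInvariantOn_rotGen_self (w : E → F) (U : Set E) (a : E) :
    InfInvariantOn w U (rotGen a a) := fun x _ => by simp [rotGen_apply]

theorem InfInvariantOn.rotGen_symm {w : E → F} {U : Set E} {a b : E}
    (h : InfInvariantOn w U (rotGen a b)) : InfInvariantOn w U (rotGen b a) := fun x hx => by
  have := h x hx
  rw [rotGen_apply] at this ⊢
  rw [← neg_sub, map_neg, this, neg_zero]

theorem InfInvariantOn.rotGen_add {w : E → F} {U : Set E} {a b c : E}
    (hb : InfInvariantOn w U (rotGen a b)) (hc : InfInvariantOn w U (rotGen a c)) :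
    InfInvariantOn w U (rotGen a (b + c)) := fun x hx => by
  have h1 := hb x hx
  have h2 := hc x hx
  rw [rotGen_apply] at h1 h2 ⊢
  rw [inner_add_left, show inner ℝ a x • (b + c) - (inner ℝ b x + inner ℝ c x) • a =
    (inner ℝ a x • b - inner ℝ b x • a) + (inner ℝ a x • c - inner ℝ c x • a) by module,
    map_add, h1, h2, add_zero]

theorem InfInvariantOn.rotGen_smul {w : E → F} {U : Set E} {a b : E} (r : ℝ)
    (hb : InfInvariantOn w U (rotGen a b)) : InfInvariantOn w U (rotGen a (r • b)) := fun x hx => by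
  have h1 := hb x hx
  rw [rotGen_apply] at h1 ⊢
  rw [real_inner_smul_left, show inner ℝ a x • (r • b) - (r * inner ℝ b x) • a =
    r • (inner ℝ a x • b - inner ℝ b x • a) by module, map_smul, h1, smul_zero]

theorem InfInvariantOn.rotGen_neg_left {w : E → F} {U : Set E} {a b : E}
    (h : InfInvariantOn w U (rotGen (-a) b)) : InfInvariantOn w U (rotGen a b) := by
  have h1 := (h.rotGen_symm.rotGen_smul (-1)).rotGen_symm
  rwa [show (-1 : ℝ) • -a = a by module] at h1

open Topology in
/-- A continuous function on an open set that vanishes off a hyperplane vanishes. -/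
theorem eq_zero_of_forall_inner_ne_zero {E G : Type*} [NormedAddCommGroup E]
    [InnerProductSpace ℝ E] [NormedAddCommGroup G] {h : E → G} {U : Set E} (hU : IsOpen U)
    (hh : ContinuousOn h U) {e : E} (he : e ≠ 0)
    (h0 : ∀ x ∈ U, inner ℝ e x ≠ 0 → h x = 0) : ∀ x ∈ U, h x = 0 := by
  intro x hx
  by_contra hne
  by_cases hex : inner ℝ e x ≠ 0
  · exact hne (h0 x hx hex)
  rw [not_not] at hex
  have hcont : Filter.Tendsto (fun t : ℝ => x + t • e) (𝓝 0) (𝓝 x) := by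
    have : Continuous fun t : ℝ => x + t • e := by fun_prop
    simpa using this.tendsto 0
  have hev : ∀ᶠ t in 𝓝[≠] (0 : ℝ), x + t • e ∈ U ∧ h (x + t • e) ≠ 0 := by
    have := (hU.eventually_mem hx).and ((hh.continuousAt (hU.mem_nhds hx)).eventually_ne hne)
    exact Filter.Eventually.filter_mono nhdsWithin_le_nhds (hcont.eventually this)
  obtain ⟨t, ⟨htU, ht⟩, ht0⟩ := (hev.and self_mem_nhdsWithin).exists
  refine ht (h0 _ htU ?_)
  rw [inner_add_right, hex, zero_add, real_inner_smul_right]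
  exact mul_ne_zero ht0 (inner_self_ne_zero.mpr he)

/-- Infinitesimal rotation invariances in the planes of `a, b` and of `a, c` give the one in the
plane of `b, c`, as `⟨a, x⟩ (b ∧ c) = ⟨b, x⟩ (a ∧ c) - ⟨c, x⟩ (a ∧ b)` at each `x`. -/
theorem InfInvariantOn.rotGen_trans {w : E → F} {U : Set E} (hU : IsOpen U)
    (hw : ContDiffOn ℝ 1 w U) {a b c : E} (ha : a ≠ 0)
    (hb : InfInvariantOn w U (rotGen a b)) (hc : InfInvariantOn w U (rotGen a c)) :
    InfInvariantOn w U (rotGen b c) := by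
  refine eq_zero_of_forall_inner_ne_zero hU
    ((hw.continuousOn_fderiv_of_isOpen hU le_rfl).clm_apply
      (rotGen b c).continuous.continuousOn) ha fun x hx hax => ?_
  have h1 := hb x hx
  have h2 := hc x hx
  have h3 : inner ℝ a x • rotGen b c x = inner ℝ b x • rotGen a c x - inner ℝ c x • rotGen a b x := by
    simp only [rotGen_apply]; module
  have h4 := congrArg (fderiv ℝ w x) h3
  rw [map_smul, map_sub, map_smul, map_smul, h1, h2, smul_zero, smul_zero, sub_zero] at h4
  exact (smul_eq_zero.mp h4).resolve_left hax

/-- If `⟨f, g⟩ ≠ 0`, the infinitesimal rotation invariances of a `C¹` function in two planes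
containing `f` and `g`, respectively, give the one in the plane of `f` and `g`. With `X = f ∧ f'` and
`Y = g ∧ g'`, a multiple of `[X, Y] x` differs from `⟨X x, Y x⟩ (f ∧ g) x` by a combination of `X x`
and `Y x`. -/
theorem InfInvariantOn.rotGen_of_inner_ne_zero [CompleteSpace E] {w : E → F} {U : Set E}
    (hU : IsOpen U) (hw : ContDiffOn ℝ 1 w U) {f f' g g' : E} (hf' : f' ≠ 0) (hg' : g' ≠ 0)
    (hff' : inner ℝ f f' = 0) (hgg' : inner ℝ g g' = 0) (hfg : inner ℝ f g ≠ 0)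
    (hX : InfInvariantOn w U (rotGen f f')) (hY : InfInvariantOn w U (rotGen g g')) :
    InfInvariantOn w U (rotGen f g) := by
  have hf : f ≠ 0 := by rintro rfl; simp at hfg
  have hg : g ≠ 0 := by rintro rfl; simp at hfg
  let S : Submodule ℝ E := Submodule.span ℝ {f, g}
  have hfS : f ∈ S := Submodule.subset_span (by simp)
  have hgS : g ∈ S := Submodule.subset_span (by simp)
  -- a vector of the plane of `a, b` orthogonal to `a` yields the invariance in that plane
  have hplane : ∀ a b c : E, a ≠ 0 → c ≠ 0 → inner ℝ a c = 0 → c ∈ Submodule.span ℝ {a, b} →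
      InfInvariantOn w U (rotGen a c) → InfInvariantOn w U (rotGen a b) := by
    intro a b c ha hc hac hcS hinv
    obtain ⟨r, s, rfl⟩ := Submodule.mem_span_pair.mp hcS
    have hs : s ≠ 0 := by
      rintro rfl
      rw [zero_smul, add_zero, real_inner_smul_right] at hac
      have hr : r = 0 := (mul_eq_zero.mp hac).resolve_right (inner_self_ne_zero.mpr ha)
      simp [hr] at hc
    have h1 := (hinv.rotGen_add ((infInvariantOn_rotGen_self w U a).rotGen_smul (-r))).rotGen_smul s⁻¹
    rwa [show s⁻¹ • (r • a + s • b + (-r) • a) = b by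
      rw [show r • a + s • b + (-r) • a = s • b by module, smul_smul, inv_mul_cancel₀ hs,
        one_smul]] at h1
  by_cases hf'S : f' ∈ S
  · exact hplane f g f' hf hf' hff' hf'S hX
  by_cases hg'S : g' ∈ S
  · refine (hplane g f g' hg hg' hgg' ?_ hY).rotGen_symm
    rwa [Set.pair_comm]
  -- `q` is a nonzero quadratic form
  let q : E → ℝ := fun x => inner ℝ (rotGen f f' x) (rotGen g g' x)
  have hq : ∃ y, q y ≠ 0 := by
    have : FiniteDimensional ℝ S := FiniteDimensional.span_of_finite ℝ (by simp)
    let P : E → E := fun z => z - S.starProjection z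
    have hPorth : ∀ z, ∀ s ∈ S, inner ℝ s (P z) = 0 := fun z s hs =>
      (Submodule.mem_orthogonal _ _).mp (S.sub_starProjection_mem_orthogonal z) s hs
    have hself : ∀ z, inner ℝ z (P z) = inner ℝ (P z) (P z) := by
      intro z
      have h1 := hPorth z _ (S.starProjection_apply_mem z)
      calc inner ℝ z (P z) = inner ℝ (P z + S.starProjection z) (P z) := by simp [P]
        _ = _ := by rw [inner_add_left, h1, add_zero]
    have hne : ∀ z, z ∉ S → inner ℝ z (P z) ≠ 0 := by
      intro z hz
      rw [hself]
      refine inner_self_ne_zero.mpr fun h0 => hz ?_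
      rw [← (sub_eq_zero.mp h0 : z = S.starProjection z).symm]
      exact S.starProjection_apply_mem z
    have hval : ∀ y, inner ℝ f y = 0 → inner ℝ g y = 0 →
        q y = inner ℝ f' y * inner ℝ g' y * inner ℝ f g := by
      intro y h1 h2
      simp only [q, rotGen_apply, h1, h2, zero_smul, zero_sub, inner_neg_neg, real_inner_smul_left,
        real_inner_smul_right]
      ring
    obtain ⟨y, h1, h2, h3, h4⟩ : ∃ y, inner ℝ f y = 0 ∧ inner ℝ g y = 0 ∧ inner ℝ f' y ≠ 0 ∧
        inner ℝ g' y ≠ 0 := by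
      by_cases hcase : inner ℝ g' (P f') = 0
      · have hcase' : inner ℝ f' (P g') = 0 := by
          have h1 := hPorth g' _ (S.starProjection_apply_mem f')
          have h2 := hPorth f' _ (S.starProjection_apply_mem g')
          have h3 : inner ℝ f' (P g') = inner ℝ (P f') (P g') := by
            calc inner ℝ f' (P g') = inner ℝ (P f' + S.starProjection f') (P g') := by simp [P]
              _ = _ := by rw [inner_add_left, h1, add_zero]
          have h4 : inner ℝ g' (P f') = inner ℝ (P g') (P f') := by
            calc inner ℝ g' (P f') = inner ℝ (P g' + S.starProjection g') (P f') := by simp [P]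
              _ = _ := by rw [inner_add_left, h2, add_zero]
          rw [h3, real_inner_comm, ← h4, hcase]
        refine ⟨P f' + P g', ?_, ?_, ?_, ?_⟩
        · rw [inner_add_right, hPorth _ f hfS, hPorth _ f hfS, add_zero]
        · rw [inner_add_right, hPorth _ g hgS, hPorth _ g hgS, add_zero]
        · rw [inner_add_right, hcase', add_zero]; exact hne _ hf'S
        · rw [inner_add_right, hcase, zero_add]; exact hne _ hg'S
      · exact ⟨P f', hPorth _ f hfS, hPorth _ g hgS, hne _ hf'S, hcase⟩
    exact ⟨y, by rw [hval y h1 h2]; exact mul_ne_zero (mul_ne_zero h3 h4) hfg⟩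
  obtain ⟨y, hy⟩ := hq
  have hbr := InfInvariantOn.commutator hU (hw.differentiableOn one_ne_zero) hX hY
  have hqw : ∀ x ∈ U, q x • fderiv ℝ w x (rotGen f g x) = 0 := by
    intro x hx
    have hid : q x • rotGen f g x =
        (inner ℝ f x * inner ℝ g x) • (rotGen f f' * rotGen g g' - rotGen g g' * rotGen f f') x
        - (inner ℝ g x * inner ℝ f (rotGen g g' x)) • rotGen f f' x
        + (inner ℝ f x * inner ℝ g (rotGen f f' x)) • rotGen g g' x := by
      simp only [q, sub_apply, mul_apply_eq_comp, rotGen_apply,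
        inner_sub_left, inner_sub_right, real_inner_smul_left, real_inner_smul_right]
      rw [real_inner_comm f g, real_inner_comm f g', real_inner_comm f' g, real_inner_comm f' g']
      module
    rw [← map_smul, hid, map_add, map_sub, map_smul, map_smul, map_smul, hbr x hx, hX x hx, hY x hx]
    simp
  intro x hx
  by_contra hne
  have hcont : ContinuousOn (fun x => fderiv ℝ w x (rotGen f g x)) U :=
    (hw.continuousOn_fderiv_of_isOpen hU le_rfl).clm_apply (rotGen f g).continuous.continuousOn
  -- otherwise `q` vanishes near `x`, contrary to `q (x + t y) + q (x - t y) = 2 q x + 2 t² q y`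
  obtain ⟨ε, hε, hball⟩ := Metric.eventually_nhds_iff_ball.mp
    ((hU.eventually_mem hx).and ((hcont.continuousAt (hU.mem_nhds hx)).eventually_ne hne))
  have hq0 : ∀ z ∈ Metric.ball x ε, q z = 0 := fun z hz =>
    (smul_eq_zero.mp (hqw z (hball z hz).1)).resolve_right (hball z hz).2
  have hy0 : y ≠ 0 := by rintro rfl; simp [q] at hy
  let t : ℝ := ε / (2 * ‖y‖)
  have htpos : 0 < t := by have := norm_pos_iff.mpr hy0; positivity
  have htn : ‖t • y‖ < ε := by
    rw [norm_smul, Real.norm_eq_abs, abs_of_pos htpos]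
    have := norm_pos_iff.mpr hy0
    simp only [t]
    field_simp
    linarith
  have h1 := hq0 (x + t • y) (by simpa using htn)
  have h2 := hq0 (x - t • y) (by simpa [dist_eq_norm] using htn)
  have h3 := hq0 x (Metric.mem_ball_self hε)
  have h4 : q (x + t • y) + q (x - t • y) = 2 * q x + 2 * t ^ 2 * q y := by
    simp only [q, map_add, map_sub, map_smul, inner_add_left, inner_add_right, inner_sub_left,
      inner_sub_right, real_inner_smul_left, real_inner_smul_right]
    ring
  rw [h1, h2, h3] at h4
  have : 2 * t ^ 2 * q y ≠ 0 := by positivity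
  exact this (by linarith)

end Infinitesimal

/-! ### Invariance under all rotations of a subspace -/

section Radial

theorem det_reflection_orthogonal_span_singleton {N : ℕ} {e : Euc N} (he : e ≠ 0) :
    LinearMap.det (hyperplaneRefl e).toLinearEquiv.toLinearMap = -1 := by
  have h := Submodule.det_reflection (Submodule.span ℝ {e})ᗮ
  rw [Submodule.orthogonal_orthogonal, finrank_span_singleton he, pow_one] at h
  exact h

theorem exists_ne_zero_inner_eq_zero {N : ℕ} (hN : 2 ≤ N) (y : Euc N) :
    ∃ g : Euc N, g ≠ 0 ∧ inner ℝ y g = 0 := by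
  have h1 := (Submodule.span ℝ {y}).finrank_add_finrank_orthogonal
  have h2 : Module.finrank ℝ (Submodule.span ℝ {y}) ≤ 1 := (finrank_span_le_card _).trans (by simp)
  rw [finrank_euclideanSpace_fin] at h1
  have h3 : 0 < Module.finrank ℝ (Submodule.span ℝ {y})ᗮ := by omega
  have := Module.nontrivial_of_finrank_pos h3
  obtain ⟨g, hg⟩ := exists_ne (0 : (Submodule.span ℝ {y})ᗮ)
  exact ⟨g, by simpa using hg, Submodule.mem_orthogonal_singleton_iff_inner_right.mp g.2⟩

theorem hyperplaneRefl_of_inner_eq_zero {N : ℕ} {e x : Euc N} (h : inner ℝ e x = 0) :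
    hyperplaneRefl e x = x :=
  Submodule.reflection_mem_subspace_eq_self
    (Submodule.mem_orthogonal_singleton_iff_inner_right.mpr h)

/-- In dimension at least two, a set invariant under rotations is a union of spheres: if a
reflection maps `x` to `y`, its composition with a reflection fixing `y` is a rotation. -/
theorem MinSym.RotationInvariant.mem_of_norm_eq {N : ℕ} (hN : 2 ≤ N) {Ω : Set (Euc N)}
    (hrot : RotationInvariant Ω) {x y : Euc N} (hx : x ∈ Ω) (hxy : ‖x‖ = ‖y‖) : y ∈ Ω := by
  by_cases hne : x = y
  · rwa [← hne]
  obtain ⟨g, hg0, hg⟩ := exists_ne_zero_inner_eq_zero hN y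
  have h1 : hyperplaneRefl (x - y) x = y := Submodule.reflection_sub hxy
  have h2 : hyperplaneRefl g y = y :=
    hyperplaneRefl_of_inner_eq_zero (by rwa [real_inner_comm])
  have h3 := hrot ((hyperplaneRefl (x - y)).trans (hyperplaneRefl g)) (by
    have hcomp : (((hyperplaneRefl (x - y)).trans (hyperplaneRefl g)).toLinearEquiv :
        Euc N →ₗ[ℝ] Euc N) = (hyperplaneRefl g).toLinearEquiv.toLinearMap ∘ₗ
          (hyperplaneRefl (x - y)).toLinearEquiv.toLinearMap := rfl
    rw [hcomp, LinearMap.det_comp, det_reflection_orthogonal_span_singleton hg0,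
      det_reflection_orthogonal_span_singleton (sub_ne_zero.mpr hne)]
    norm_num)
  rw [← h3]
  exact ⟨x, hx, by rw [LinearIsometryEquiv.trans_apply, h1, h2]⟩

variable {E F : Type*} [NormedAddCommGroup E] [InnerProductSpace ℝ E]
  [NormedAddCommGroup F] [NormedSpace ℝ F]

theorem exists_rotation_in_plane {W : Submodule ℝ E} [FiniteDimensional ℝ W]
    (hW : 2 ≤ Module.finrank ℝ W) {a b : E} (ha : a ∈ W) (hb : b ∈ W) (hab : ‖a‖ = ‖b‖)
    (ha0 : a ≠ 0) : ∃ c ∈ W, inner ℝ a c = 0 ∧ ‖c‖ = ‖a‖ ∧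
      ∃ θ : ℝ, b = Real.cos θ • a + Real.sin θ • c := by
  have hna : ‖a‖ ≠ 0 := norm_ne_zero_iff.mpr ha0
  obtain ⟨c₀, hc₀W, hc₀, hac₀, r, s, hrs⟩ : ∃ c₀ ∈ W, c₀ ≠ 0 ∧ inner ℝ a c₀ = 0 ∧
      ∃ r s : ℝ, b = r • a + s • c₀ := by
    let b' := b - (inner ℝ a b / ‖a‖ ^ 2) • a
    have hb'W : b' ∈ W := W.sub_mem hb (W.smul_mem _ ha)
    have hb' : inner ℝ a b' = 0 := by
      simp only [b', inner_sub_right, real_inner_smul_right, real_inner_self_eq_norm_sq]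
      field_simp
      ring
    by_cases h0 : b' = 0
    · have h1 : (Submodule.span ℝ {(⟨a, ha⟩ : W)})ᗮ ≠ ⊥ := by
        intro hbot
        have h1 := (Submodule.span ℝ {(⟨a, ha⟩ : W)}).finrank_add_finrank_orthogonal
        have h2 : Module.finrank ℝ (Submodule.span ℝ {(⟨a, ha⟩ : W)}) ≤ 1 :=
          (finrank_span_le_card _).trans (by simp)
        rw [hbot, finrank_bot] at h1
        omega
      obtain ⟨c, hc, hc0⟩ := Submodule.exists_mem_ne_zero_of_ne_bot h1
      rw [Submodule.mem_orthogonal_singleton_iff_inner_right] at hc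
      refine ⟨c, c.2, by simpa using hc0, by simpa using hc, inner ℝ a b / ‖a‖ ^ 2, 0, ?_⟩
      rw [zero_smul, add_zero]
      exact sub_eq_zero.mp h0
    · refine ⟨b', hb'W, h0, hb', inner ℝ a b / ‖a‖ ^ 2, 1, ?_⟩
      simp [b']
  have hnc : ‖c₀‖ ≠ 0 := norm_ne_zero_iff.mpr hc₀
  refine ⟨(‖a‖ / ‖c₀‖) • c₀, W.smul_mem _ hc₀W, by rw [real_inner_smul_right, hac₀, mul_zero], ?_, ?_⟩
  · rw [norm_smul, norm_div, norm_norm, norm_norm, div_mul_cancel₀ _ hnc]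
  have hsq : r ^ 2 + (s * ‖c₀‖ / ‖a‖) ^ 2 = 1 := by
    have h1 : ‖b‖ ^ 2 = r ^ 2 * ‖a‖ ^ 2 + s ^ 2 * ‖c₀‖ ^ 2 := by
      rw [hrs, ← real_inner_self_eq_norm_sq, inner_add_left, inner_add_right, inner_add_right]
      simp only [real_inner_smul_left, real_inner_smul_right, real_inner_comm a c₀, hac₀]
      rw [real_inner_self_eq_norm_sq, real_inner_self_eq_norm_sq]
      ring
    rw [← hab] at h1
    field_simp
    linarith
  have hz : ‖(⟨r, s * ‖c₀‖ / ‖a‖⟩ : ℂ)‖ = 1 := by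
    rw [← pow_left_inj₀ (norm_nonneg _) zero_le_one two_ne_zero, Complex.sq_norm,
      Complex.normSq_mk]
    linarith
  have hz0 : (⟨r, s * ‖c₀‖ / ‖a‖⟩ : ℂ) ≠ 0 := by
    intro h; rw [h] at hz; simp at hz
  refine ⟨Complex.arg ⟨r, s * ‖c₀‖ / ‖a‖⟩, ?_⟩
  rw [Complex.cos_arg hz0, Complex.sin_arg, hz, div_one, div_one, smul_smul, hrs]
  congr 2
  field_simp

/-- A `C¹` function that is infinitesimally invariant under the rotations of `W`, `dim W ≥ 2`, takes
the same value at points that a rotation of `W` exchanges: it is constant along a circle that joins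
them. -/
theorem eq_of_infInvariantOn_rotGen {w : E → F} {Ω : Set E} (hΩ : IsOpen Ω)
    (hsph : ∀ x y : E, x ∈ Ω → ‖x‖ = ‖y‖ → y ∈ Ω) (hw : DifferentiableOn ℝ w Ω)
    {W : Submodule ℝ E} [FiniteDimensional ℝ W] (hW : 2 ≤ Module.finrank ℝ W)
    (hinv : ∀ a ∈ W, ∀ b ∈ W, InfInvariantOn w Ω (rotGen a b)) {p a b : E} (hp : p ∈ Wᗮ)
    (ha : a ∈ W) (hb : b ∈ W) (hab : ‖a‖ = ‖b‖) (hpa : p + a ∈ Ω) : w (p + a) = w (p + b) := by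
  by_cases ha0 : a = 0
  · have : b = 0 := by rw [← norm_eq_zero, ← hab, ha0, norm_zero]
    rw [ha0, this]
  obtain ⟨c, hcW, hac, hca, θ, hθ⟩ := exists_rotation_in_plane hW ha hb hab ha0
  have hap : inner ℝ a p = 0 := (Submodule.mem_orthogonal _ _).mp hp a ha
  have hcp : inner ℝ c p = 0 := (Submodule.mem_orthogonal _ _).mp hp c hcW
  have hca0 : inner ℝ c a = 0 := by rwa [real_inner_comm]
  have hpa0 : inner ℝ p a = 0 := by rwa [real_inner_comm]
  have hpc0 : inner ℝ p c = 0 := by rwa [real_inner_comm]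
  let γ : ℝ → E := fun t => p + (Real.cos t • a + Real.sin t • c)
  have hγn : ∀ t, ‖p + a‖ = ‖γ t‖ := by
    intro t
    rw [← pow_left_inj₀ (norm_nonneg _) (norm_nonneg _) two_ne_zero, ← real_inner_self_eq_norm_sq,
      ← real_inner_self_eq_norm_sq]
    simp only [γ, inner_add_left, inner_add_right, real_inner_smul_left, real_inner_smul_right,
      hap, hcp, hac, hca0, hpa0, hpc0]
    simp only [real_inner_self_eq_norm_sq, hca]
    linear_combination (-‖a‖ ^ 2) * Real.cos_sq_add_sin_sq t
  have hγd : ∀ t, HasDerivAt γ (-Real.sin t • a + Real.cos t • c) t := fun t =>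
    ((((Real.hasDerivAt_cos t).smul_const a).add
      ((Real.hasDerivAt_sin t).smul_const c))).const_add p
  have hd : ∀ t, HasDerivAt (fun t => w (γ t)) 0 t := by
    intro t
    have hU : γ t ∈ Ω := hsph _ _ hpa (hγn t)
    have h1 := ((hw.differentiableAt (hΩ.mem_nhds hU)).hasFDerivAt).comp_hasDerivAt t (hγd t)
    have h2 : rotGen a c (γ t) = ‖a‖ ^ 2 • (-Real.sin t • a + Real.cos t • c) := by
      rw [rotGen_apply]
      simp only [γ, inner_add_right, real_inner_smul_right, hap, hcp, hac, hca0,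
        real_inner_self_eq_norm_sq, hca]
      module
    have h3 := hinv a ha c hcW (γ t) hU
    rw [h2, map_smul] at h3
    rw [(smul_eq_zero.mp h3).resolve_left (by simpa using ha0)] at h1
    exact h1
  have hconst := is_const_of_deriv_eq_zero (fun t => (hd t).differentiableAt)
    (fun t => (hd t).deriv) 0 θ
  simpa [γ, ← hθ] using hconst

theorem radiallySymmetric_of_infInvariantOn {N m : ℕ} (hN : 2 ≤ N) {Ω : Set (Euc N)}
    (hΩ : IsOpen Ω) (hrot : RotationInvariant Ω) {w : Euc N → Euc m}
    (hw : DifferentiableOn ℝ w Ω) {W : Submodule ℝ (Euc N)} (hW : 2 ≤ Module.finrank ℝ W)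
    (hinv : ∀ a ∈ W, ∀ b ∈ W, InfInvariantOn w Ω (rotGen a b)) :
    RadiallySymmetric Ω Wᗮ w := by
  classical
  let pr : Euc N → Wᗮ := fun x => Wᗮ.orthogonalProjectionOnto x
  have hmem : ∀ x, x - (pr x : Euc N) ∈ W := fun x => by
    have := Wᗮ.sub_starProjection_mem_orthogonal x
    rwa [Submodule.orthogonal_orthogonal] at this
  refine ⟨fun v r => if h : ∃ x ∈ Ω, pr x = v ∧ ‖x - (pr x : Euc N)‖ = r then w h.choose else 0,
    fun x hx => ?_⟩
  have hex : ∃ y ∈ Ω, pr y = pr x ∧ ‖y - (pr y : Euc N)‖ = ‖x - (pr x : Euc N)‖ :=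
    ⟨x, hx, rfl, rfl⟩
  change w x = if h : ∃ y ∈ Ω, pr y = pr x ∧ ‖y - (pr y : Euc N)‖ = ‖x - (pr x : Euc N)‖ then
    w h.choose else 0
  rw [dif_pos hex]
  obtain ⟨hyΩ, hy1, hy2⟩ := hex.choose_spec
  set y := hex.choose
  have h1 : (pr x : Euc N) + (x - (pr x : Euc N)) = x := by abel
  have h2 : (pr x : Euc N) + (y - (pr y : Euc N)) = y := by rw [hy1]; abel
  have := eq_of_infInvariantOn_rotGen hΩ (fun a b ha hab => hrot.mem_of_norm_eq hN ha hab) hw hW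
    hinv (pr x).2 (hmem x) (hmem y) hy2.symm (by rwa [h1])
  rwa [h1, h2] at this

end Radial

/-! ### Blocks of invariant directions -/

section Blocks

variable {E F : Type*} [NormedAddCommGroup E] [InnerProductSpace ℝ E] [FiniteDimensional ℝ E]
  [NormedAddCommGroup F] [NormedSpace ℝ F]

/-- Finitely many pairwise orthogonal subspaces of dimension at most `d` can be mapped injectively
to `ℝᵈ` by one linear map: the sum of the orthogonal projections, each followed by an embedding. -/
theorem exists_linearMap_injOn_of_orthogonal {d : ℕ} {S : Set (Submodule ℝ E)}
    (hbot : ⊥ ∉ S) (hdim : ∀ W ∈ S, Module.finrank ℝ W ≤ d)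
    (horth : ∀ W ∈ S, ∀ W' ∈ S, W ≠ W' → W ⟂ W') :
    ∃ T : E →ₗ[ℝ] (Fin d → ℝ), ∀ W ∈ S, ∀ x ∈ W, T x = 0 → x = 0 := by
  have hfam : OrthogonalFamily ℝ (fun W : S => W.1) fun W => W.1.subtypeₗᵢ :=
    OrthogonalFamily.of_pairwise fun W W' hne => horth _ W.2 _ W'.2 fun h => hne (Subtype.ext h)
  have hfin : Finite S := by
    have := WellFoundedGT.finite_ne_bot_of_iSupIndep hfam.independent
    refine (Set.finite_univ_iff (α := S)).mp (this.subset fun W _ => ?_)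
    exact fun h => hbot (h ▸ W.2)
  have := Fintype.ofFinite S
  have hinj : ∀ W : S, ∃ t : W.1 →ₗ[ℝ] (Fin d → ℝ), Function.Injective t := by
    intro W
    obtain ⟨e⟩ : Nonempty (Fin (Module.finrank ℝ W.1) ↪ Fin d) :=
      Function.Embedding.nonempty_of_card_le (by simpa using hdim W.1 W.2)
    have h1 := linearIndependent_iff_injective_fintypeLinearCombination.mp
      ((Pi.basisFun ℝ (Fin d)).linearIndependent.comp e e.injective)
    exact ⟨Fintype.linearCombination ℝ _ ∘ₗ (Module.finBasis ℝ W.1).equivFun.toLinearMap,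
      h1.comp (Module.finBasis ℝ W.1).equivFun.injective⟩
  choose t ht using hinj
  refine ⟨∑ W : S, t W ∘ₗ (W.1.orthogonalProjectionOnto : E →ₗ[ℝ] W.1), fun W hW x hx h0 => ?_⟩
  rw [LinearMap.sum_apply, Finset.sum_eq_single ⟨W, hW⟩] at h0
  · rw [LinearMap.comp_apply] at h0
    have h1 := (map_eq_zero_iff _ (ht ⟨W, hW⟩)).mp h0
    have h2 : W.orthogonalProjectionOnto x = ⟨x, hx⟩ :=
      Submodule.orthogonalProjectionOnto_mem_subspace_eq_self ⟨x, hx⟩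
    have h3 : W.orthogonalProjectionOnto x = 0 := h1
    rw [h2] at h3
    simpa using h3
  · intro W' _ hne
    rw [LinearMap.comp_apply]
    have h1 : W'.1.orthogonalProjectionOnto x = 0 := by
      rw [Submodule.orthogonalProjectionOnto_eq_zero_iff]
      exact horth W hW W'.1 W'.2 (fun h => hne (Subtype.ext h.symm)) hx
    have h2 : (W'.1.orthogonalProjectionOnto : E →ₗ[ℝ] W'.1) x = 0 := h1
    rw [h2, map_zero]
  · simp

/-- Suppose that `w` is infinitesimally invariant under rotations in the plane of any two
nonorthogonal members of `Z`, and that `Z` meets the kernel of every linear map to `ℝᵈ`. Then `w` is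
infinitesimally invariant under all rotations of a subspace of dimension greater than `d`. Invariance
in the plane of `f` and `g` is an equivalence relation, and the spans of its classes in `Z` are
pairwise orthogonal; if all had dimension at most `d`, they would all embed by one map to `ℝᵈ`. -/
theorem exists_submodule_infInvariantOn {w : E → F} {Ω : Set E} (hΩ : IsOpen Ω)
    (hw : ContDiffOn ℝ 1 w Ω) {Z : Set E} (hZ0 : 0 ∉ Z) {d : ℕ}
    (hZ : ∀ T : E →ₗ[ℝ] (Fin d → ℝ), ∃ f ∈ Z, T f = 0)
    (hinv : ∀ f ∈ Z, ∀ g ∈ Z, inner ℝ f g ≠ 0 → InfInvariantOn w Ω (rotGen f g)) :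
    ∃ W : Submodule ℝ E, d < Module.finrank ℝ W ∧
      ∀ a ∈ W, ∀ b ∈ W, InfInvariantOn w Ω (rotGen a b) := by
  have hne : ∀ f ∈ Z, f ≠ 0 := fun f hf h => hZ0 (h ▸ hf)
  let M : E → Submodule ℝ E := fun f =>
    { carrier := {g | InfInvariantOn w Ω (rotGen f g)}
      add_mem' := fun ha hb => ha.rotGen_add hb
      zero_mem' := fun x _ => by simp [rotGen_apply]
      smul_mem' := fun r _ ha => ha.rotGen_smul r }
  let B : E → Submodule ℝ E := fun f => Submodule.span ℝ {g | g ∈ Z ∧ g ∈ M f}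
  have hBM : ∀ f, B f ≤ M f := fun f => Submodule.span_le.mpr fun g hg => hg.2
  have hself : ∀ f ∈ Z, f ∈ B f := fun f hf =>
    Submodule.subset_span ⟨hf, infInvariantOn_rotGen_self w Ω f⟩
  have htrans : ∀ a b c : E, a ≠ 0 → b ∈ M a → c ∈ M a → c ∈ M b := fun a b c ha hb hc =>
    InfInvariantOn.rotGen_trans hΩ hw ha hb hc
  have hsymm : ∀ a b : E, b ∈ M a → a ∈ M b := fun a b h => InfInvariantOn.rotGen_symm h
  by_contra! hcon
  have hdim : ∀ f ∈ Z, Module.finrank ℝ (B f) ≤ d := by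
    intro f hf
    by_contra! hlt
    obtain ⟨a, ha, b, hb, hab⟩ := hcon (B f) hlt
    exact hab (htrans f a b (hne f hf) (hBM f ha) (hBM f hb))
  have horth : ∀ f ∈ Z, ∀ g ∈ Z, B f ≠ B g → B f ⟂ B g := by
    intro f hf g hg hfg
    have hnot : g ∉ M f := by
      intro hgf
      apply hfg
      have hset : {h | h ∈ Z ∧ h ∈ M f} = {h | h ∈ Z ∧ h ∈ M g} := by
        ext h
        exact and_congr_right fun _ => ⟨fun hh => htrans f g h (hne f hf) hgf hh,
          fun hh => htrans g f h (hne g hg) (hsymm f g hgf) hh⟩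
      simp only [B, hset]
    rw [Submodule.isOrtho_span]
    intro a ha b hb
    by_contra hab
    have h1 : b ∈ M a := hinv a ha.1 b hb.1 hab
    have h2 : b ∈ M f := htrans a f b (hne a ha.1) (hsymm _ _ ha.2) h1
    exact hnot (htrans b f g (hne b hb.1) (hsymm _ _ h2) (hsymm _ _ hb.2))
  obtain ⟨T, hT⟩ := exists_linearMap_injOn_of_orthogonal (S := B '' Z) (d := d)
    (by
      rintro ⟨f, hf, hbot⟩
      have := hself f hf
      rw [hbot, Submodule.mem_bot] at this
      exact hne f hf this)
    (by rintro _ ⟨f, hf, rfl⟩; exact hdim f hf)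
    (by
      rintro _ ⟨f, hf, rfl⟩ _ ⟨g, hg, rfl⟩ h
      exact horth f hf g hg h)
  obtain ⟨f, hf, hTf⟩ := hZ T
  exact hne f hf (hT _ ⟨f, hf, rfl⟩ f (hself f hf) hTf)

end Blocks

/-! ### Weak gradients -/

section WeakGradient

variable {N m : ℕ}

theorem MeasureTheory.LocallyIntegrableOn.congr_eqOn {E F : Type*} [NormedAddCommGroup E]
    [LocallyCompactSpace E] [MeasurableSpace E] [BorelSpace E] [NormedAddCommGroup F] {f g : E → F}
    {U : Set E} {μ : Measure E} (hU : IsOpen U) (hf : LocallyIntegrableOn f U μ)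
    (hfg : EqOn f g U) : LocallyIntegrableOn g U μ := by
  rw [locallyIntegrableOn_iff hU.isLocallyClosed] at hf ⊢
  exact fun k hk hkc => (hf k hk hkc).congr_fun (hfg.mono hk) hkc.measurableSet

theorem fderiv_eq_zero_of_notMem_tsupport {E : Type*} [NormedAddCommGroup E] [NormedSpace ℝ E]
    {φ : E → ℝ} {x : E} (hx : x ∉ tsupport φ) : fderiv ℝ φ x = 0 :=
  Function.notMem_support.mp fun h => hx (support_fderiv_subset ℝ h)

theorem MinSym.IsWeakGradient.mono {Ω U : Set (Euc N)} (hΩ : IsOpen Ω) (hUΩ : U ⊆ Ω)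
    {v : Euc N → Euc m} {D : Euc N → (Euc N →L[ℝ] Euc m)} (h : IsWeakGradient Ω v D) :
    IsWeakGradient U v D := by
  refine ⟨h.1.mono_set hUΩ, h.2.1.mono_set hUΩ, fun φ hφ hc hs e => ?_⟩
  have h1 := h.2.2 φ hφ hc (hs.trans hUΩ) e
  rw [setIntegral_eq_of_subset_of_forall_sdiff_eq_zero hΩ.measurableSet hUΩ,
    setIntegral_eq_of_subset_of_forall_sdiff_eq_zero hΩ.measurableSet hUΩ] at h1
  · exact h1
  · intro x hx
    rw [image_eq_zero_of_notMem_tsupport fun hx' => hx.2 (hs hx'), zero_smul]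
  · intro x hx
    rw [fderiv_eq_zero_of_notMem_tsupport fun hx' => hx.2 (hs hx')]
    simp

theorem MinSym.IsWeakGradient.congr {U : Set (Euc N)} (hU : IsOpen U) {v v' : Euc N → Euc m}
    {D : Euc N → (Euc N →L[ℝ] Euc m)} (h : IsWeakGradient U v D) (hv : EqOn v v' U) :
    IsWeakGradient U v' D := by
  refine ⟨h.1.congr_eqOn hU hv, h.2.1, fun φ hφ hc hs e => ?_⟩
  rw [← h.2.2 φ hφ hc hs e]
  exact setIntegral_congr_fun hU.measurableSet fun x hx => by simp only [hv hx]

/-- Weak gradients are unique up to null sets, by the fundamental lemma of the calculus of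
variations. -/
theorem MinSym.IsWeakGradient.ae_eq {U : Set (Euc N)} (hU : IsOpen U) {v : Euc N → Euc m}
    {D D' : Euc N → (Euc N →L[ℝ] Euc m)} (h : IsWeakGradient U v D) (h' : IsWeakGradient U v D') :
    ∀ᵐ x ∂volume, x ∈ U → D x = D' x := by
  have happly : ∀ (e : Euc N) {A : Euc N → (Euc N →L[ℝ] Euc m)},
      LocallyIntegrableOn A U volume → LocallyIntegrableOn (fun x => A x e) U volume := by
    intro e A hA
    rw [locallyIntegrableOn_iff hU.isLocallyClosed] at hA ⊢
    exact fun k hk hkc =>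
      (ContinuousLinearMap.apply ℝ (Euc m) e).integrable_comp (hA k hk hkc)
  have hint : ∀ (e : Euc N) {A : Euc N → (Euc N →L[ℝ] Euc m)}, LocallyIntegrableOn A U volume →
      ∀ φ : Euc N → ℝ, ContDiff ℝ ∞ φ → HasCompactSupport φ → tsupport φ ⊆ U →
      Integrable (fun x => φ x • A x e) volume := by
    intro e A hA φ hφ hc hs
    have h1 : IntegrableOn (fun x => φ x • A x e) (tsupport φ) volume :=
      (((happly e hA).integrableOn_compact_subset hs hc)).continuousOn_smul
        hφ.continuous.continuousOn hc
    refine (integrableOn_iff_integrable_of_support_subset ?_).mp h1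
    intro x hx
    by_contra hx'
    exact hx (by simp only [image_eq_zero_of_notMem_tsupport hx', zero_smul])
  have hcoord : ∀ e : Euc N, ∀ᵐ x ∂volume, x ∈ U → D x e - D' x e = 0 := by
    intro e
    refine hU.ae_eq_zero_of_integral_contDiff_smul_eq_zero
      ((happly e h.2.1).sub (happly e h'.2.1)) fun φ hφ hc hs => ?_
    have h0 : ∀ A : Euc N → (Euc N →L[ℝ] Euc m),
        ∫ x in U, φ x • A x e = ∫ x, φ x • A x e := fun A =>
      setIntegral_eq_integral_of_forall_compl_eq_zero fun x hx => by
        rw [image_eq_zero_of_notMem_tsupport fun hx' => hx (hs hx'), zero_smul]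
    simp only [smul_sub]
    rw [integral_sub (hint e h.2.1 φ hφ hc hs) (hint e h'.2.1 φ hφ hc hs), ← h0, ← h0, sub_eq_zero,
      ← neg_inj, ← h.2.2 φ hφ hc hs e, ← h'.2.2 φ hφ hc hs e]
  have hall := ae_all_iff.mpr fun i : Fin N => hcoord (EuclideanSpace.single i 1)
  filter_upwards [hall] with x hx hxU
  have hlin : (D x : Euc N →ₗ[ℝ] Euc m) = D' x :=
    (EuclideanSpace.basisFun (Fin N) ℝ).toBasis.ext fun i => by
      simpa [sub_eq_zero] using hx i hxU
  exact ContinuousLinearMap.coe_injective hlin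

theorem MinSym.IsWeakGradient.comp_isometry {Ω : Set (Euc N)} (hΩ : IsOpen Ω)
    {v : Euc N → Euc m} {D : Euc N → (Euc N →L[ℝ] Euc m)} (h : IsWeakGradient Ω v D)
    (R : Euc N ≃ₗᵢ[ℝ] Euc N) :
    IsWeakGradient (R ⁻¹' Ω) (v ∘ R)
      (fun x => (D (R x)).comp (R.toContinuousLinearEquiv : Euc N →L[ℝ] Euc N)) := by
  have hmp : MeasurePreserving R volume volume := R.measurePreserving
  have hemb : MeasurableEmbedding R := R.toHomeomorph.measurableEmbedding
  have hΩ' : IsOpen (R ⁻¹' Ω) := hΩ.preimage R.continuous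
  have hcomp : ∀ {G : Type} [NormedAddCommGroup G] {f : Euc N → G},
      LocallyIntegrableOn f Ω volume → LocallyIntegrableOn (f ∘ R) (R ⁻¹' Ω) volume := by
    intro G _ f hf
    rw [locallyIntegrableOn_iff hΩ'.isLocallyClosed]
    intro k hk hkc
    have h1 : IntegrableOn f (R '' k) volume :=
      hf.integrableOn_compact_subset (image_subset_iff.mpr hk) (hkc.image R.continuous)
    rw [← hmp.integrableOn_comp_preimage hemb, preimage_image_eq _ R.injective] at h1
    exact h1
  refine ⟨hcomp h.1, ?_, fun φ hφ hc hs e => ?_⟩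
  · have h1 := hcomp h.2.1
    rw [locallyIntegrableOn_iff hΩ'.isLocallyClosed] at h1 ⊢
    intro k hk hkc
    exact ((ContinuousLinearMap.compL ℝ (Euc N) (Euc N) (Euc m)).flip
      (R.toContinuousLinearEquiv : Euc N →L[ℝ] Euc N)).integrable_comp (h1 k hk hkc)
  · let ψ : Euc N → ℝ := φ ∘ R.symm
    have hψ : ContDiff ℝ ∞ ψ := hφ.comp R.symm.contDiff
    have hts : tsupport ψ ⊆ R.symm ⁻¹' tsupport φ :=
      closure_minimal (fun x hx => subset_closure hx)
        ((isClosed_tsupport φ).preimage R.symm.continuous)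
    have hψc : HasCompactSupport ψ := hc.comp_homeomorph R.symm.toHomeomorph
    have hψs : tsupport ψ ⊆ Ω := fun x hx => by simpa using hs (hts hx)
    have h1 := h.2.2 ψ hψ hψc hψs (R e)
    have hfd : ∀ x, fderiv ℝ ψ (R x) (R e) = fderiv ℝ φ x e := by
      intro x
      have h2 : HasFDerivAt ψ ((fderiv ℝ φ (R.symm (R x))).comp
          (R.symm.toContinuousLinearEquiv : Euc N →L[ℝ] Euc N)) (R x) :=
        ((hφ.differentiable (by simp)).differentiableAt.hasFDerivAt).comp (R x)
          R.symm.toContinuousLinearEquiv.hasFDerivAt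
      rw [h2.fderiv]
      simp
    rw [← hmp.setIntegral_preimage_emb hemb (fun y => fderiv ℝ ψ y (R e) • v y) Ω,
      ← hmp.setIntegral_preimage_emb hemb (fun y => ψ y • D y (R e)) Ω] at h1
    simp only [hfd] at h1
    simpa [ψ] using h1

theorem gradNorm_comp_isometry (D : Euc N →L[ℝ] Euc m) (R : Euc N ≃ₗᵢ[ℝ] Euc N) :
    gradNorm (D.comp (R.toContinuousLinearEquiv : Euc N →L[ℝ] Euc N)) = gradNorm D := by
  have key : ∀ b : OrthonormalBasis (Fin N) ℝ (Euc N), ∑ i, ‖D (b i)‖ ^ 2 =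
      ∑ j, ‖ContinuousLinearMap.adjoint D (EuclideanSpace.basisFun (Fin m) ℝ j)‖ ^ 2 := by
    intro b
    calc ∑ i, ‖D (b i)‖ ^ 2
        = ∑ i, ∑ j, ‖inner ℝ (EuclideanSpace.basisFun (Fin m) ℝ j) (D (b i))‖ ^ 2 :=
          Finset.sum_congr rfl fun i _ =>
            ((EuclideanSpace.basisFun (Fin m) ℝ).sum_sq_norm_inner_right _).symm
      _ = ∑ j, ∑ i, ‖inner ℝ (EuclideanSpace.basisFun (Fin m) ℝ j) (D (b i))‖ ^ 2 :=
          Finset.sum_comm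
      _ = _ := Finset.sum_congr rfl fun j _ => by
          rw [← b.sum_sq_norm_inner_left]
          exact Finset.sum_congr rfl fun i _ => by rw [ContinuousLinearMap.adjoint_inner_left]
  have h1 := key (EuclideanSpace.basisFun (Fin N) ℝ)
  have h2 := key ((EuclideanSpace.basisFun (Fin N) ℝ).map R)
  simp only [EuclideanSpace.basisFun_apply, OrthonormalBasis.map_apply] at h1 h2
  simp only [gradNorm]
  congr 1
  rw [h1, ← h2]
  rfl

theorem isWeakGradient_weakGrad {Ω : Set (Euc N)} {v : Euc N → Euc m}
    (h : WeaklyDifferentiable Ω v) : IsWeakGradient Ω v (weakGrad Ω v) := by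
  rw [weakGrad, dif_pos h]
  exact h.choose_spec

/-- If `w = v ∘ R` on an open set `U`, for an isometry `R`, then the densities of `w` and `v`
correspond under `R` on `U`. -/
theorem density_ae_eq_of_eqOn_comp {Ω U : Set (Euc N)} (hΩ : IsOpen Ω) (hU : IsOpen U)
    (hUΩ : U ⊆ Ω) {R : Euc N ≃ₗᵢ[ℝ] Euc N} (hUR : U ⊆ R ⁻¹' Ω) {v w : Euc N → Euc m}
    (hv : WeaklyDifferentiable Ω v) (hw : WeaklyDifferentiable Ω w) (hwv : EqOn w (v ∘ R) U)
    (H : ℝ → Euc m → ℝ → ℝ) :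
    density Ω H w =ᵐ[volume.restrict U] fun x => density Ω H v (R x) := by
  have h1 : IsWeakGradient U w (weakGrad Ω w) := (isWeakGradient_weakGrad hw).mono hΩ hUΩ
  have h2 := (((isWeakGradient_weakGrad hv).comp_isometry hΩ R).mono
    (hΩ.preimage R.continuous) hUR).congr hU hwv.symm
  rw [Filter.EventuallyEq, ae_restrict_iff' hU.measurableSet]
  filter_upwards [h1.ae_eq hU h2] with x hx hxU
  simp only [density, hx hxU, hwv hxU, gradNorm_comp_isometry, R.norm_map, Function.comp_apply]

end WeakGradient

/-! ### Reflections across hyperplanes -/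

section Reflection

variable {N m : ℕ}

theorem hyperplaneRefl_apply (e x : Euc N) :
    hyperplaneRefl e x = x - (2 * (inner ℝ e x / ‖e‖ ^ 2)) • e := by
  rw [hyperplaneRefl, Submodule.reflection_orthogonal_apply, Submodule.reflection_singleton_apply]
  simp only [RCLike.ofReal_real_eq_id, id_eq]
  module

theorem hyperplaneRefl_self (e : Euc N) : hyperplaneRefl e e = -e := by
  by_cases he : e = 0
  · simp [he]
  rw [hyperplaneRefl_apply, real_inner_self_eq_norm_sq, div_self (by simpa using he)]
  module

theorem hyperplaneRefl_hyperplaneRefl (e x : Euc N) : hyperplaneRefl e (hyperplaneRefl e x) = x :=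
  Submodule.reflection_reflection _ _

theorem inner_hyperplaneRefl (e x : Euc N) : inner ℝ e (hyperplaneRefl e x) = -inner ℝ e x := by
  have h := (hyperplaneRefl e).inner_map_map e (hyperplaneRefl e x)
  rw [hyperplaneRefl_hyperplaneRefl, hyperplaneRefl_self, inner_neg_left] at h
  exact h.symm

theorem inner_hyperplaneRefl_of_orthogonal {e g : Euc N} (h : inner ℝ e g = 0) (x : Euc N) :
    inner ℝ e (hyperplaneRefl g x) = inner ℝ e x := by
  rw [hyperplaneRefl_apply, inner_sub_right, real_inner_smul_right, h, mul_zero, sub_zero]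

theorem hyperplaneRefl_comm {e g : Euc N} (h : inner ℝ e g = 0) (x : Euc N) :
    hyperplaneRefl e (hyperplaneRefl g x) = hyperplaneRefl g (hyperplaneRefl e x) := by
  have h' : inner ℝ g e = 0 := by rwa [real_inner_comm]
  rw [hyperplaneRefl_apply e, hyperplaneRefl_apply g (hyperplaneRefl e x),
    inner_hyperplaneRefl_of_orthogonal h, inner_hyperplaneRefl_of_orthogonal h',
    hyperplaneRefl_apply g, hyperplaneRefl_apply e]
  module

theorem reflectPos_of_pos {e x : Euc N} (hx : 0 < inner ℝ e x) (f : Euc N → Euc m) :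
    reflectPos e f x = f x := if_pos hx.le

theorem reflectPos_of_neg {e x : Euc N} (hx : inner ℝ e x < 0) (f : Euc N → Euc m) :
    reflectPos e f x = f (hyperplaneRefl e x) := if_neg (not_le.mpr hx)

theorem reflectPos_comp_refl (e : Euc N) (f : Euc N → Euc m) :
    reflectPos e f ∘ hyperplaneRefl e = reflectPos e f := by
  funext x
  rw [Function.comp_apply]
  rcases lt_trichotomy (inner ℝ e x) 0 with h | h | h
  · rw [reflectPos_of_neg h, reflectPos_of_pos (by rw [inner_hyperplaneRefl]; linarith)]
  · rw [hyperplaneRefl_of_inner_eq_zero h]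
  · rw [reflectPos_of_pos h, reflectPos_of_neg (by rw [inner_hyperplaneRefl]; linarith),
      hyperplaneRefl_hyperplaneRefl]

theorem reflectPos_comp_refl_of_orthogonal {e g : Euc N} (h : inner ℝ e g = 0)
    {f : Euc N → Euc m} (hf : f ∘ hyperplaneRefl g = f) :
    reflectPos e f ∘ hyperplaneRefl g = reflectPos e f := by
  funext x
  simp only [reflectPos, Function.comp_apply, inner_hyperplaneRefl_of_orthogonal h,
    hyperplaneRefl_comm h]
  rw [show f (hyperplaneRefl g x) = f x from congrFun hf x,
    show f (hyperplaneRefl g (hyperplaneRefl e x)) = f (hyperplaneRefl e x) from congrFun hf _]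

theorem MinSym.RotationInvariant.map_mem_iff (hN : 2 ≤ N) {Ω : Set (Euc N)}
    (hrot : RotationInvariant Ω) (R : Euc N ≃ₗᵢ[ℝ] Euc N) (x : Euc N) : R x ∈ Ω ↔ x ∈ Ω :=
  ⟨fun h => hrot.mem_of_norm_eq hN h (R.norm_map x),
    fun h => hrot.mem_of_norm_eq hN h (R.norm_map x).symm⟩

/-- The part of `Ω` in the open half-space of vectors with positive inner product with `e`. -/
def halfPart (Ω : Set (Euc N)) (e : Euc N) : Set (Euc N) := {x | x ∈ Ω ∧ 0 < inner ℝ e x}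

theorem isOpen_halfPart {Ω : Set (Euc N)} (hΩ : IsOpen Ω) (e : Euc N) : IsOpen (halfPart Ω e) :=
  hΩ.inter (isOpen_lt (f := fun _ : Euc N => (0 : ℝ)) (g := fun x => inner ℝ e x) continuous_const
    (by fun_prop))

theorem halfPart_subset (Ω : Set (Euc N)) (e : Euc N) : halfPart Ω e ⊆ Ω := fun _ h => h.1

theorem preimage_halfPart (hN : 2 ≤ N) {Ω : Set (Euc N)} (hrot : RotationInvariant Ω) (e : Euc N) :
    hyperplaneRefl e ⁻¹' halfPart Ω e = halfPart Ω (-e) := by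
  ext x
  simp only [halfPart, mem_preimage, mem_ofPred_eq, hrot.map_mem_iff hN, inner_hyperplaneRefl,
    inner_neg_left]

theorem ae_inner_ne_zero {e : Euc N} (he : e ≠ 0) : ∀ᵐ x : Euc N, inner ℝ e x ≠ 0 := by
  have h1 : (Submodule.span ℝ {e})ᗮ ≠ ⊤ := by
    intro h
    have : e ∈ (Submodule.span ℝ {e})ᗮ := h ▸ Submodule.mem_top
    rw [Submodule.mem_orthogonal_singleton_iff_inner_right] at this
    exact he (inner_self_eq_zero.mp this)
  have h2 := Measure.addHaar_submodule volume _ h1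
  rw [ae_iff]
  convert h2 using 2
  ext x
  simp [Submodule.mem_orthogonal_singleton_iff_inner_right]

theorem setIntegral_eq_add_halfPart {Ω : Set (Euc N)} (hΩ : IsOpen Ω) {e : Euc N} (he : e ≠ 0)
    {h : Euc N → ℝ} (hh : IntegrableOn h Ω) :
    ∫ x in Ω, h x = (∫ x in halfPart Ω e, h x) + ∫ x in halfPart Ω (-e), h x := by
  have hdisj : Disjoint (halfPart Ω e) (halfPart Ω (-e)) := by
    rw [Set.disjoint_left]
    intro x hx hx'
    have := hx'.2
    rw [inner_neg_left] at this
    linarith [hx.2]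
  rw [← setIntegral_union hdisj (isOpen_halfPart hΩ _).measurableSet
    (hh.mono_set (halfPart_subset _ _)) (hh.mono_set (halfPart_subset _ _))]
  refine setIntegral_congr_set ?_
  filter_upwards [ae_inner_ne_zero he] with x hx
  refine propext ⟨fun hxΩ => ?_, fun hx => hx.elim (fun h => h.1) fun h => h.1⟩
  rcases lt_or_gt_of_ne hx with h | h
  · exact Or.inr ⟨hxΩ, by rw [inner_neg_left]; linarith⟩
  · exact Or.inl ⟨hxΩ, h⟩

/-- The functional at `v_{Π⁺}` is twice the contribution of the half-space `Π⁺`. -/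
theorem functional_reflectPos (hN : 2 ≤ N) {Ω : Set (Euc N)} (hΩ : IsOpen Ω)
    (hrot : RotationInvariant Ω) {e : Euc N} (he : e ≠ 0) {v : Euc N → Euc m}
    (hv : WeaklyDifferentiable Ω v) (hw : WeaklyDifferentiable Ω (reflectPos e v))
    (H : ℝ → Euc m → ℝ → ℝ) (hint : IntegrableOn (density Ω H (reflectPos e v)) Ω) :
    functional Ω H (reflectPos e v) = 2 * ∫ x in halfPart Ω e, density Ω H v x := by
  have h1 : ∫ x in halfPart Ω e, density Ω H (reflectPos e v) x =
      ∫ x in halfPart Ω e, density Ω H v x := by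
    refine integral_congr_ae ?_
    have := density_ae_eq_of_eqOn_comp hΩ (isOpen_halfPart hΩ e) (halfPart_subset Ω e)
      (R := LinearIsometryEquiv.refl ℝ _) (halfPart_subset Ω e) hv hw
      (fun x hx => reflectPos_of_pos hx.2 v) H
    simpa using this
  have h2 : ∫ x in halfPart Ω (-e), density Ω H (reflectPos e v) x =
      ∫ x in halfPart Ω e, density Ω H v x := by
    rw [← (hyperplaneRefl e).measurePreserving.setIntegral_preimage_emb
      (hyperplaneRefl e).toHomeomorph.measurableEmbedding _ (halfPart Ω e), preimage_halfPart hN hrot]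
    refine integral_congr_ae ?_
    refine density_ae_eq_of_eqOn_comp hΩ (isOpen_halfPart hΩ (-e)) (halfPart_subset Ω (-e))
      (R := hyperplaneRefl e) (fun x hx => (hrot.map_mem_iff hN _ x).mpr hx.1) hv hw
      (fun x hx => reflectPos_of_neg ?_ v) H
    have := hx.2
    rw [inner_neg_left] at this
    linarith
  rw [functional, setIntegral_eq_add_halfPart hΩ he hint, h1, h2]
  ring

end Reflection

/-! ### Hyperplanes that bisect the constraints -/

section Balanced

variable {N m k : ℕ}

/-- The imbalance of `h` across `e^⊥`: its integral over the part of `Ω` on the positive side minus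
the integral over the part on the negative side. -/
noncomputable def imbalance (Ω : Set (Euc N)) (h : Euc N → ℝ) (e : Euc N) : ℝ :=
  ∫ x in Ω, (SignType.sign (inner ℝ e x : ℝ) : ℝ) * h x

theorem imbalance_neg (Ω : Set (Euc N)) (h : Euc N → ℝ) (e : Euc N) :
    imbalance Ω h (-e) = -imbalance Ω h e := by
  simp only [imbalance, inner_neg_left, Left.sign_neg, SignType.coe_neg, neg_mul, integral_neg]

theorem measurable_sign_inner (e : Euc N) :
    Measurable fun x : Euc N => (SignType.sign (inner ℝ e x : ℝ) : ℝ) := by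
  have h : (fun x : Euc N => (SignType.sign (inner ℝ e x : ℝ) : ℝ)) = fun x =>
      if 0 < (inner ℝ e x : ℝ) then 1 else if (inner ℝ e x : ℝ) < 0 then -1 else 0 := by
    funext x
    rw [sign_apply]
    split_ifs <;> simp
  rw [h]
  refine Measurable.ite (measurableSet_lt measurable_const (by fun_prop)) measurable_const
    (Measurable.ite (measurableSet_lt (by fun_prop) measurable_const) measurable_const
      measurable_const)

theorem abs_sign_le_one (r : ℝ) : |(SignType.sign r : ℝ)| ≤ 1 := by
  rw [sign_apply]
  split_ifs <;> simp

theorem integrableOn_sign_mul {Ω : Set (Euc N)} {h : Euc N → ℝ} (hh : IntegrableOn h Ω)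
    (e : Euc N) : IntegrableOn (fun x => (SignType.sign (inner ℝ e x : ℝ) : ℝ) * h x) Ω := by
  refine Integrable.bdd_mul (c := 1) hh (measurable_sign_inner e).aestronglyMeasurable
    (Filter.Eventually.of_forall fun x => ?_)
  exact abs_sign_le_one _

theorem continuousOn_imbalance {Ω : Set (Euc N)} {h : Euc N → ℝ} (hh : IntegrableOn h Ω) :
    ContinuousOn (imbalance Ω h) {0}ᶜ := by
  intro e he
  refine ContinuousAt.continuousWithinAt ?_
  refine continuousAt_of_dominated (bound := fun x => ‖h x‖)
    (Filter.Eventually.of_forall fun e => (integrableOn_sign_mul hh e).aestronglyMeasurable)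
    (Filter.Eventually.of_forall fun e => Filter.Eventually.of_forall fun x => ?_) hh.norm ?_
  · rw [norm_mul]
    exact mul_le_of_le_one_left (norm_nonneg _) (abs_sign_le_one _)
  · refine ae_restrict_of_ae ?_
    filter_upwards [ae_inner_ne_zero he] with x hx
    refine ContinuousAt.mul ?_ continuousAt_const
    have h1 : ContinuousAt (fun r : ℝ => (SignType.sign r : ℝ)) (inner ℝ e x) :=
      (continuous_of_discreteTopology (f := fun s : SignType => (s : ℝ))).continuousAt.comp
        (continuousAt_sign_of_ne_zero hx)
    exact ContinuousAt.comp (f := fun e : Euc N => (inner ℝ e x : ℝ)) h1 (by fun_prop)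

theorem imbalance_eq_sub {Ω : Set (Euc N)} (hΩ : IsOpen Ω) {e : Euc N} (he : e ≠ 0)
    {h : Euc N → ℝ} (hh : IntegrableOn h Ω) :
    imbalance Ω h e = (∫ x in halfPart Ω e, h x) - ∫ x in halfPart Ω (-e), h x := by
  rw [imbalance, setIntegral_eq_add_halfPart hΩ he (integrableOn_sign_mul hh e), sub_eq_add_neg,
    ← integral_neg]
  congr 1
  · refine setIntegral_congr_fun (isOpen_halfPart hΩ _).measurableSet fun x hx => ?_
    simp [sign_pos hx.2]
  · refine setIntegral_congr_fun (isOpen_halfPart hΩ _).measurableSet fun x hx => ?_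
    have := hx.2
    rw [inner_neg_left, Left.neg_pos_iff] at this
    simp [sign_neg this]

/-- The normal vectors of the hyperplanes through the origin that bisect all the constraint
integrals of `v`. -/
def balancedNormals (Ω : Set (Euc N)) (G : Fin k → ℝ → Euc m → ℝ → ℝ) (v : Euc N → Euc m) :
    Set (Euc N) :=
  {e | e ≠ 0 ∧ ∀ j, imbalance Ω (density Ω (G j) v) e = 0}

theorem neg_mem_balancedNormals {Ω : Set (Euc N)} {G : Fin k → ℝ → Euc m → ℝ → ℝ}
    {v : Euc N → Euc m} {e : Euc N} (he : e ∈ balancedNormals Ω G v) :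
    -e ∈ balancedNormals Ω G v :=
  ⟨neg_ne_zero.mpr he.1, fun j => by rw [imbalance_neg, he.2 j, neg_zero]⟩

/-- A bisecting hyperplane exists with normal vector in the kernel of any given linear map to `ℝᵈ`,
`k + d < N`: Borsuk–Ulam for the odd map formed by the imbalances and that linear map. -/
theorem exists_mem_balancedNormals {Ω : Set (Euc N)} {G : Fin k → ℝ → Euc m → ℝ → ℝ}
    {v : Euc N → Euc m} (hint : ∀ j, IntegrableOn (density Ω (G j) v) Ω) {d : ℕ} (hd : k + d < N)
    (T : Euc N →ₗ[ℝ] (Fin d → ℝ)) : ∃ e ∈ balancedNormals Ω G v, T e = 0 := by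
  obtain ⟨e, he0, he⟩ := borsuk_ulam (ι := Fin k ⊕ Fin d) (E := Euc N) (by simpa using hd)
    (f := fun e => Sum.elim (fun j => imbalance Ω (density Ω (G j) v) e) (T e))
    (by
      rw [continuousOn_pi]
      rintro (j | i)
      · exact continuousOn_imbalance (hint j)
      · exact ((continuous_apply i).comp T.continuous_of_finiteDimensional).continuousOn)
    (by
      intro x _
      funext i
      rcases i with j | i
      · simp [imbalance_neg]
      · simp)
  exact ⟨e, ⟨he0, fun j => by simpa using congrFun he (Sum.inl j)⟩,
    funext fun i => by simpa using congrFun he (Sum.inr i)⟩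

/-- If `v` is symmetric with respect to two orthogonal hyperplanes, then every hyperplane whose
normal vector is in the plane of their normals bisects the constraints: the composition of the two
reflections preserves `v` and is `-1` on that plane. -/
theorem mem_balancedNormals_of_symmetric (hN : 2 ≤ N) {Ω : Set (Euc N)} (hΩ : IsOpen Ω)
    (hrot : RotationInvariant Ω) {G : Fin k → ℝ → Euc m → ℝ → ℝ} {v : Euc N → Euc m}
    (hv : WeaklyDifferentiable Ω v) {f g : Euc N} (hfg : inner ℝ f g = 0)
    (hf : v ∘ hyperplaneRefl f = v) (hg : v ∘ hyperplaneRefl g = v) {r s : ℝ}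
    (hne : r • f + s • g ≠ 0) : r • f + s • g ∈ balancedNormals Ω G v := by
  refine ⟨hne, fun j => ?_⟩
  set e := r • f + s • g
  let R := (hyperplaneRefl f).trans (hyperplaneRefl g)
  have hgf : inner ℝ g f = 0 := by rwa [real_inner_comm]
  have hRe : R e = -e := by
    simp only [R, e, LinearIsometryEquiv.trans_apply, map_add, map_smul, hyperplaneRefl_self,
      hyperplaneRefl_of_inner_eq_zero hfg, map_neg, hyperplaneRefl_of_inner_eq_zero hgf]
    module
  have hvR : EqOn v (v ∘ R) Ω := fun x _ => by
    have h1 := congrFun hg (hyperplaneRefl f x)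
    have h2 := congrFun hf x
    simp only [Function.comp_apply] at h1 h2
    simp only [R, Function.comp_apply, LinearIsometryEquiv.trans_apply, h1, h2]
  have hpre : R ⁻¹' Ω = Ω := by ext x; exact hrot.map_mem_iff hN R x
  have hdens := density_ae_eq_of_eqOn_comp hΩ hΩ Subset.rfl (R := R) hpre.symm.subset hv hv hvR (G j)
  have h1 : imbalance Ω (density Ω (G j) v) e = -imbalance Ω (density Ω (G j) v) e := by
    conv_lhs => rw [imbalance]
    rw [← R.measurePreserving.setIntegral_preimage_emb R.toHomeomorph.measurableEmbedding, hpre,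
      imbalance, ← integral_neg]
    refine integral_congr_ae ?_
    filter_upwards [hdens] with x hx
    have h2 : inner ℝ e (R x) = -inner ℝ e x := by
      rw [← neg_neg e, ← hRe, inner_neg_left, LinearIsometryEquiv.inner_map_map, hRe]
      simp
    rw [h2, ← hx, Left.sign_neg, SignType.coe_neg, neg_mul]
  linarith

end Balanced

/-! ### Symmetry of minimizers -/

section Minimizers

variable {N m k : ℕ}

/-- If `e^⊥` bisects the constraints of the minimizer `u`, then `u_{Π⁺}` is a minimizer: both
`u_{Π⁺}` and `u_{Π⁻}` are admissible and the sum of their energies is twice that of `u`. -/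
theorem MinSym.IsMinimizer.reflectPos (hN : 2 ≤ N) {Ω : Set (Euc N)} (hΩ : IsOpen Ω)
    (hrot : RotationInvariant Ω) {X : Set (Euc N → Euc m)}
    (hX : ∀ v ∈ X, WeaklyDifferentiable Ω v) {F : ℝ → Euc m → ℝ → ℝ}
    {G : Fin k → ℝ → Euc m → ℝ → ℝ} {c : Fin k → ℝ}
    (hF : ∀ v ∈ X, IntegrableOn (density Ω F v) Ω)
    (hG : ∀ j, ∀ v ∈ X, IntegrableOn (density Ω (G j) v) Ω) (A1 : ReflectionClosed X)
    {u : Euc N → Euc m} (hu : IsMinimizer Ω X F G c u) {e : Euc N}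
    (he : e ∈ balancedNormals Ω G u) : IsMinimizer Ω X F G c (reflectPos e u) := by
  have hmem : ∀ a : Euc N, a ≠ 0 → MinSym.reflectPos a u ∈ X := fun a ha => (A1 u hu.1.1 a ha).1
  have hfun : ∀ (a : Euc N), a ≠ 0 → ∀ H : ℝ → Euc m → ℝ → ℝ,
      (∀ v ∈ X, IntegrableOn (density Ω H v) Ω) →
      functional Ω H (MinSym.reflectPos a u) = 2 * ∫ x in halfPart Ω a, density Ω H u x :=
    fun a ha H hH => functional_reflectPos hN hΩ hrot ha (hX u hu.1.1) (hX _ (hmem a ha)) H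
      (hH _ (hmem a ha))
  have hsplit : ∀ H : ℝ → Euc m → ℝ → ℝ, (∀ v ∈ X, IntegrableOn (density Ω H v) Ω) →
      functional Ω H u = (∫ x in halfPart Ω e, density Ω H u x) +
        ∫ x in halfPart Ω (-e), density Ω H u x :=
    fun H hH => setIntegral_eq_add_halfPart hΩ he.1 (hH u hu.1.1)
  have hbal : ∀ j, ∫ x in halfPart Ω e, density Ω (G j) u x =
      ∫ x in halfPart Ω (-e), density Ω (G j) u x := fun j => by
    have h := he.2 j
    rwa [imbalance_eq_sub hΩ he.1 (hG j u hu.1.1), sub_eq_zero] at h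
  have hne : -e ≠ 0 := neg_ne_zero.mpr he.1
  have hneg := hu.2 _ (hmem (-e) hne) fun j => by
    rw [hfun _ hne _ (hG j), ← hu.1.2 j, hsplit _ (hG j), hbal j]; ring
  rw [hfun _ hne _ hF, hsplit _ hF] at hneg
  refine ⟨⟨hmem e he.1, fun j => ?_⟩, fun v hv hvc => le_trans ?_ (hu.2 v hv hvc)⟩
  · rw [hfun _ he.1 _ (hG j), ← hu.1.2 j, hsplit _ (hG j), hbal j]; ring
  · rw [hfun _ he.1 _ hF, hsplit _ hF]
    linarith

open Topology Filter in
/-- If `u` and `u_{Π⁺}` both have `C¹` representatives, the normal derivative of `u` vanishes on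
`Π`: the derivatives of the representative of `u_{Π⁺}` from the two sides are opposite. -/
theorem fderiv_normal_eq_zero (hN : 2 ≤ N) {Ω : Set (Euc N)} (hΩ : IsOpen Ω)
    (hrot : RotationInvariant Ω) {u w w' : Euc N → Euc m} {e : Euc N} (he : e ≠ 0)
    (hw : IsC1Rep Ω u w) (hw' : IsC1Rep Ω (reflectPos e u) w') {x : Euc N} (hx : x ∈ Ω)
    (hex : inner ℝ e x = 0) : fderiv ℝ w x e = 0 := by
  have hUo := isOpen_halfPart hΩ
  have huw : ∀ᵐ y, y ∈ Ω → u y = w y := (ae_restrict_iff' hΩ.measurableSet).mp hw.2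
  have huw' : ∀ᵐ y, y ∈ Ω → reflectPos e u y = w' y := (ae_restrict_iff' hΩ.measurableSet).mp hw'.2
  have hpos : EqOn w' w (halfPart Ω e) := by
    refine Measure.eqOn_open_of_ae_eq (μ := volume) ?_ (hUo e)
      (hw'.1.continuousOn.mono (halfPart_subset Ω e)) (hw.1.continuousOn.mono (halfPart_subset Ω e))
    rw [EventuallyEq, ae_restrict_iff' (hUo e).measurableSet]
    filter_upwards [huw, huw'] with y h1 h2 hy
    rw [← h1 hy.1, ← h2 hy.1, reflectPos_of_pos hy.2]
  have hmaps : MapsTo (hyperplaneRefl e) Ω Ω := fun y hy => (hrot.map_mem_iff hN _ y).mpr hy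
  have hneg : EqOn w' (w ∘ hyperplaneRefl e) (halfPart Ω (-e)) := by
    refine Measure.eqOn_open_of_ae_eq (μ := volume) ?_ (hUo _)
      (hw'.1.continuousOn.mono (halfPart_subset Ω _))
      ((hw.1.continuousOn.comp (hyperplaneRefl e).continuous.continuousOn hmaps).mono
        (halfPart_subset Ω _))
    rw [EventuallyEq, ae_restrict_iff' (hUo _).measurableSet]
    have huw2 := (hyperplaneRefl e).measurePreserving.quasiMeasurePreserving.ae huw
    filter_upwards [huw2, huw'] with y h1 h2 hy
    have hy2 := hy.2
    rw [inner_neg_left] at hy2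
    rw [← h2 hy.1, reflectPos_of_neg (by linarith), Function.comp_apply, h1 (hmaps hy.1)]
  have hdc : ∀ {z : Euc N → Euc m}, ContDiffOn ℝ 1 z Ω → ContinuousOn (fun y => fderiv ℝ z y e) Ω :=
    fun hz => (hz.continuousOn_fderiv_of_isOpen hΩ le_rfl).clm_apply continuousOn_const
  have hdpos : ∀ y ∈ halfPart Ω e, fderiv ℝ w' y e = fderiv ℝ w y e := fun y hy => by
    rw [(hpos.eventuallyEq_of_mem ((hUo e).mem_nhds hy)).fderiv_eq]
  have hdneg : ∀ y ∈ halfPart Ω (-e), fderiv ℝ w' y e = -fderiv ℝ w (hyperplaneRefl e y) e := by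
    intro y hy
    have h1 : HasFDerivAt (w ∘ hyperplaneRefl e) ((fderiv ℝ w (hyperplaneRefl e y)).comp
        ((hyperplaneRefl e).toContinuousLinearEquiv : Euc N →L[ℝ] Euc N)) y :=
      (((hw.1.differentiableOn one_ne_zero).differentiableAt
        (hΩ.mem_nhds (hmaps hy.1))).hasFDerivAt).comp y
        (hyperplaneRefl e).toContinuousLinearEquiv.hasFDerivAt
    rw [(hneg.eventuallyEq_of_mem ((hUo _).mem_nhds hy)).fderiv_eq, h1.fderiv]
    simp [hyperplaneRefl_self]
  have hee : 0 < inner ℝ e e := real_inner_self_pos.mpr he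
  -- approach `x` along the normal from either side
  have happ : ∀ s : ℝ, Tendsto (fun t : ℝ => x + (t * s) • e) (𝓝[>] 0) (𝓝 x) := by
    intro s
    have : Continuous fun t : ℝ => x + (t * s) • e := by fun_prop
    simpa using (this.tendsto 0).mono_left nhdsWithin_le_nhds
  have hlim : ∀ {z : Euc N → Euc m}, ContDiffOn ℝ 1 z Ω → ∀ s : ℝ,
      Tendsto (fun t : ℝ => fderiv ℝ z (x + (t * s) • e) e) (𝓝[>] 0) (𝓝 (fderiv ℝ z x e)) :=
    fun hz s => (((hdc hz).continuousAt (hΩ.mem_nhds hx)).tendsto).comp (happ s)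
  have hΩev : ∀ s : ℝ, ∀ᶠ t in 𝓝[>] (0 : ℝ), x + (t * s) • e ∈ Ω := fun s =>
    (happ s).eventually (hΩ.mem_nhds hx)
  have h1 : fderiv ℝ w' x e = fderiv ℝ w x e := by
    refine tendsto_nhds_unique_of_eventuallyEq (hlim hw'.1 1) (hlim hw.1 1) ?_
    filter_upwards [hΩev 1, self_mem_nhdsWithin] with t ht ht0
    refine hdpos _ ⟨ht, ?_⟩
    rw [inner_add_right, hex, zero_add, real_inner_smul_right, mul_one]
    exact mul_pos ht0 hee
  have h2 : fderiv ℝ w' x e = -fderiv ℝ w x e := by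
    refine tendsto_nhds_unique_of_eventuallyEq (hlim hw'.1 (-1)) (hlim hw.1 1).neg ?_
    filter_upwards [hΩev (-1), self_mem_nhdsWithin] with t ht ht0
    rw [hdneg _ ⟨ht, ?_⟩]
    · rw [map_add, map_smul, hyperplaneRefl_of_inner_eq_zero hex, hyperplaneRefl_self]
      congr 3
      module
    · rw [inner_neg_left, inner_add_right, hex, zero_add, real_inner_smul_right]
      have : 0 < t * inner ℝ e e := mul_pos ht0 hee
      linarith
  have h3 : (2 : ℝ) • fderiv ℝ w x e = 0 := by
    rw [two_smul]
    nth_rewrite 1 [← h1]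
    rw [h2, neg_add_cancel]
  exact (smul_eq_zero.mp h3).resolve_left two_ne_zero

/-- The data of the minimization problem: an open rotation invariant domain, a class of weakly
differentiable functions closed under reflections, integrable densities, and minimizers with `C¹`
representatives. -/
structure IsReflectiveProblem (Ω : Set (Euc N)) (X : Set (Euc N → Euc m)) (F : ℝ → Euc m → ℝ → ℝ)
    (G : Fin k → ℝ → Euc m → ℝ → ℝ) (c : Fin k → ℝ) : Prop where
  isOpen : IsOpen Ω
  rotationInvariant : RotationInvariant Ω
  weaklyDifferentiable : ∀ v ∈ X, WeaklyDifferentiable Ω v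
  integrableOn_energy : ∀ v ∈ X, IntegrableOn (density Ω F v) Ω
  integrableOn_constraint : ∀ j, ∀ v ∈ X, IntegrableOn (density Ω (G j) v) Ω
  reflectionClosed : ReflectionClosed X
  exists_isC1Rep : ∀ w, IsMinimizer Ω X F G c w → ∃ w', IsC1Rep Ω w w'

variable {Ω : Set (Euc N)} {X : Set (Euc N → Euc m)} {F : ℝ → Euc m → ℝ → ℝ}
  {G : Fin k → ℝ → Euc m → ℝ → ℝ} {c : Fin k → ℝ}

theorem IsReflectiveProblem.isMinimizer_reflectPos (hP : IsReflectiveProblem Ω X F G c)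
    (hN : 2 ≤ N) {u : Euc N → Euc m} (hu : IsMinimizer Ω X F G c u) {e : Euc N}
    (he : e ∈ balancedNormals Ω G u) : IsMinimizer Ω X F G c (reflectPos e u) :=
  hu.reflectPos hN hP.isOpen hP.rotationInvariant hP.weaklyDifferentiable hP.integrableOn_energy
    hP.integrableOn_constraint hP.reflectionClosed he

/-- A minimizer that is symmetric with respect to two orthogonal hyperplanes is infinitesimally
invariant under the rotations in the plane of their normals: every hyperplane with normal in that
plane bisects the constraints, and the field of the rotations is normal to one of them at each
point. -/
theorem IsReflectiveProblem.infInvariantOn_of_symmetric (hP : IsReflectiveProblem Ω X F G c)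
    (hN : 2 ≤ N) {v w : Euc N → Euc m} (hv : IsMinimizer Ω X F G c v) (hw : IsC1Rep Ω v w)
    {f g : Euc N} (hfg : inner ℝ f g = 0) (hf : v ∘ hyperplaneRefl f = v)
    (hg : v ∘ hyperplaneRefl g = v) : InfInvariantOn w Ω (rotGen f g) := by
  intro x hx
  have heq : rotGen f g x = (-inner ℝ g x) • f + (inner ℝ f x) • g := by
    rw [rotGen_apply]; module
  by_cases hne : rotGen f g x = 0
  · rw [hne, map_zero]
  have hmem : rotGen f g x ∈ balancedNormals Ω G v := by
    rw [heq] at hne ⊢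
    exact mem_balancedNormals_of_symmetric hN hP.isOpen hP.rotationInvariant
      (hP.weaklyDifferentiable v hv.1.1) hfg hf hg hne
  obtain ⟨w', hw'⟩ := hP.exists_isC1Rep _ (hP.isMinimizer_reflectPos hN hv hmem)
  refine fderiv_normal_eq_zero hN hP.isOpen hP.rotationInvariant hne hw hw' hx ?_
  rw [rotGen_apply, inner_sub_left, real_inner_smul_left, real_inner_smul_left]
  ring

/-- If `f^⊥` bisects the constraints of the minimizer `u`, then on the positive side of `f^⊥` the
function `u` is infinitesimally invariant under the rotations in some plane containing `f`: reflect
`u` across `f^⊥`, then across an orthogonal hyperplane that bisects the constraints of the result,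
using either side of the latter. -/
theorem IsReflectiveProblem.exists_infInvariantOn_halfPart (hP : IsReflectiveProblem Ω X F G c)
    (hk : k + 2 ≤ N) {u w : Euc N → Euc m} (hu : IsMinimizer Ω X F G c u) (hw : IsC1Rep Ω u w)
    {f : Euc N} (hf : f ∈ balancedNormals Ω G u) :
    ∃ f' : Euc N, f' ≠ 0 ∧ inner ℝ f f' = 0 ∧ InfInvariantOn w (halfPart Ω f) (rotGen f f') := by
  have hN : 2 ≤ N := by omega
  have hΩ := hP.isOpen
  have hv := hP.isMinimizer_reflectPos hN hu hf
  obtain ⟨g, hg, hT⟩ := exists_mem_balancedNormals (v := reflectPos f u) (d := 1)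
    (fun j => hP.integrableOn_constraint j _ hv.1.1) (by omega)
    (LinearMap.pi fun _ => (innerSL ℝ f : Euc N →ₗ[ℝ] ℝ))
  have hfg : inner ℝ f g = 0 := by simpa using congrFun hT 0
  refine ⟨g, hg.1, hfg, ?_⟩
  have hside : ∀ a ∈ balancedNormals Ω G (reflectPos f u), inner ℝ f a = 0 →
      ∀ x ∈ halfPart Ω f, 0 < inner ℝ a x → fderiv ℝ w x (rotGen f a x) = 0 := by
    intro a ha hfa x hx hax
    have hz := hP.isMinimizer_reflectPos hN hv ha
    obtain ⟨z, hzrep⟩ := hP.exists_isC1Rep _ hz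
    have hinv := hP.infInvariantOn_of_symmetric hN hz hzrep hfa
      (reflectPos_comp_refl_of_orthogonal (by rwa [real_inner_comm]) (reflectPos_comp_refl f u))
      (reflectPos_comp_refl a _)
    have hUo : IsOpen (halfPart (halfPart Ω f) a) := isOpen_halfPart (isOpen_halfPart hΩ f) a
    have hUΩ : halfPart (halfPart Ω f) a ⊆ Ω := fun y hy => hy.1.1
    have heq : EqOn w z (halfPart (halfPart Ω f) a) := by
      refine Measure.eqOn_open_of_ae_eq (μ := volume) ?_ hUo (hw.1.continuousOn.mono hUΩ)
        (hzrep.1.continuousOn.mono hUΩ)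
      rw [Filter.EventuallyEq, ae_restrict_iff' hUo.measurableSet]
      filter_upwards [(ae_restrict_iff' hΩ.measurableSet).mp hw.2,
        (ae_restrict_iff' hΩ.measurableSet).mp hzrep.2] with y h1 h2 hy
      rw [← h1 hy.1.1, ← h2 hy.1.1, reflectPos_of_pos hy.2, reflectPos_of_pos hy.1.2]
    rw [(heq.eventuallyEq_of_mem (hUo.mem_nhds ⟨hx, hax⟩)).fderiv_eq]
    exact hinv x hx.1
  refine eq_zero_of_forall_inner_ne_zero (isOpen_halfPart hΩ f)
    (((hw.1.continuousOn_fderiv_of_isOpen hΩ le_rfl).mono (halfPart_subset Ω f)).clm_apply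
      (rotGen f g).continuous.continuousOn) hg.1 fun x hx hgx => ?_
  rcases lt_or_gt_of_ne hgx with h | h
  · have h1 := hside (-g) (neg_mem_balancedNormals hg) (by rw [inner_neg_right, hfg, neg_zero]) x hx
      (by rw [inner_neg_left]; linarith)
    rw [rotGen_apply, inner_neg_left, show inner ℝ f x • -g - -inner ℝ g x • f =
      -(inner ℝ f x • g - inner ℝ g x • f) by module, map_neg, neg_eq_zero, ← rotGen_apply] at h1
    exact h1
  · exact hside g hg hfg x hx h

/-- If two nonorthogonal hyperplanes bisect the constraints of the minimizer `u`, then `u` is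
infinitesimally invariant under the rotations in the plane of their normals: this holds in each of
the four open quadrants that they bound. -/
theorem IsReflectiveProblem.infInvariantOn_of_inner_ne_zero (hP : IsReflectiveProblem Ω X F G c)
    (hk : k + 2 ≤ N) {u w : Euc N → Euc m} (hu : IsMinimizer Ω X F G c u) (hw : IsC1Rep Ω u w)
    {f g : Euc N} (hf : f ∈ balancedNormals Ω G u) (hg : g ∈ balancedNormals Ω G u)
    (hfg : inner ℝ f g ≠ 0) : InfInvariantOn w Ω (rotGen f g) := by
  have hΩ := hP.isOpen
  have hquad : ∀ a ∈ balancedNormals Ω G u, ∀ b ∈ balancedNormals Ω G u, inner ℝ a b ≠ 0 →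
      InfInvariantOn w (halfPart (halfPart Ω a) b) (rotGen a b) := by
    intro a ha b hb hab
    obtain ⟨a', ha'0, haa', hinva⟩ := hP.exists_infInvariantOn_halfPart hk hu hw ha
    obtain ⟨b', hb'0, hbb', hinvb⟩ := hP.exists_infInvariantOn_halfPart hk hu hw hb
    exact InfInvariantOn.rotGen_of_inner_ne_zero (isOpen_halfPart (isOpen_halfPart hΩ a) b)
      (hw.1.mono fun y hy => hy.1.1) ha'0 hb'0 haa' hbb' hab (hinva.mono fun y hy => hy.1)
      (hinvb.mono fun y hy => ⟨hy.1.1, hy.2⟩)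
  have hhalf : ∀ a ∈ balancedNormals Ω G u, inner ℝ a g ≠ 0 →
      ∀ x ∈ halfPart Ω a, inner ℝ g x ≠ 0 → fderiv ℝ w x (rotGen a g x) = 0 := by
    intro a ha hag x hx hgx
    rcases lt_or_gt_of_ne hgx with h | h
    · have h1 := hquad a ha (-g) (neg_mem_balancedNormals hg) (by rwa [inner_neg_right, neg_ne_zero])
      exact h1.rotGen_symm.rotGen_neg_left.rotGen_symm x
        ⟨hx, by rw [inner_neg_left]; linarith⟩
    · exact hquad a ha g hg hag x ⟨hx, h⟩
  have hcont : ContinuousOn (fun x => fderiv ℝ w x (rotGen f g x)) Ω :=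
    (hw.1.continuousOn_fderiv_of_isOpen hΩ le_rfl).clm_apply (rotGen f g).continuous.continuousOn
  refine eq_zero_of_forall_inner_ne_zero hΩ hcont hf.1 fun x hx hfx => ?_
  rcases lt_or_gt_of_ne hfx with h | h
  · refine eq_zero_of_forall_inner_ne_zero (isOpen_halfPart hΩ (-f))
      (hcont.mono (halfPart_subset Ω _)) hg.1 (fun y hy hgy => ?_) x
      ⟨hx, by rw [inner_neg_left]; linarith⟩
    have h1 : InfInvariantOn w {y} (rotGen (-f) g) := by
      rintro _ rfl
      exact hhalf (-f) (neg_mem_balancedNormals hf) (by rwa [inner_neg_left, neg_ne_zero]) _ hy hgy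
    exact h1.rotGen_neg_left y rfl
  · exact eq_zero_of_forall_inner_ne_zero (isOpen_halfPart hΩ f)
      (hcont.mono (halfPart_subset Ω _)) hg.1 (hhalf f hf hfg) x ⟨hx, h⟩

end Minimizers

theorem theorem1 {N m k : ℕ} (hk : k + 2 ≤ N)
    (Ω : Set (Euc N)) (hΩ : IsOpen Ω) (hrot : RotationInvariant Ω)
    (X : Set (Euc N → Euc m)) (hX : ∀ v ∈ X, WeaklyDifferentiable Ω v)
    (F : ℝ → Euc m → ℝ → ℝ) (G : Fin k → ℝ → Euc m → ℝ → ℝ) (c : Fin k → ℝ)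
    (hF : ∀ v ∈ X, IntegrableOn (density Ω F v) Ω)
    (hG : ∀ j, ∀ v ∈ X, IntegrableOn (density Ω (G j) v) Ω)
    (A1 : ReflectionClosed X)
    (A2 : ∀ w, IsMinimizer Ω X F G c w → ∃ w', IsC1Rep Ω w w')
    (u : Euc N → Euc m) (hu : IsMinimizer Ω X F G c u) :
    ∃ V : Submodule ℝ (Euc N), Module.finrank ℝ V = k ∧
      ∀ w, IsC1Rep Ω u w → RadiallySymmetric Ω V w := by
  have hN : 2 ≤ N := by omega
  have hP : IsReflectiveProblem Ω X F G c := ⟨hΩ, hrot, hX, hF, hG, A1, A2⟩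
  obtain ⟨w₀, hw₀⟩ := A2 u hu
  obtain ⟨W, hWdim, hW⟩ := exists_submodule_infInvariantOn (d := N - k - 1) hΩ hw₀.1
    (Z := balancedNormals Ω G u) (fun h => h.1 rfl)
    (exists_mem_balancedNormals (fun j => hG j u hu.1.1) (by omega))
    fun f hf g hg hfg => hP.infInvariantOn_of_inner_ne_zero hk hu hw₀ hf hg hfg
  obtain ⟨W', hW'W, hW'dim⟩ : ∃ W' ≤ W, Module.finrank ℝ W' = N - k := by
    obtain ⟨b, hb⟩ := exists_linearIndependent_of_le_finrank (R := ℝ) (M := W) (n := N - k)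
      (by omega)
    refine ⟨Submodule.span ℝ (Set.range fun i => (b i : Euc N)), ?_, ?_⟩
    · rw [Submodule.span_le]
      rintro _ ⟨i, rfl⟩
      exact (b i).2
    · have := finrank_span_eq_card (hb.map' W.subtype W.ker_subtype)
      rwa [Fintype.card_fin] at this
  refine ⟨W'ᗮ, ?_, fun w hw => ?_⟩
  · have := W'.finrank_add_finrank_orthogonal
    rw [finrank_euclideanSpace_fin] at this
    omega
  · obtain ⟨g, hg⟩ := radiallySymmetric_of_infInvariantOn hN hΩ hrot
      (hw₀.1.differentiableOn one_ne_zero) (W := W') (by omega)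
      fun a ha b hb => hW a (hW'W ha) b (hW'W hb)
    have heq : EqOn w w₀ Ω := Measure.eqOn_open_of_ae_eq (hw.2.symm.trans hw₀.2) hΩ
      hw.1.continuousOn hw₀.1.continuousOn
    exact ⟨g, fun x hx => by rw [heq hx, hg x hx]⟩
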